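/- Let $\gamma,\Gamma\subset\mathbb{CP}^2$ be smooth conics and let $n\ge 3$. A (labelled) Poncelet $n$-gon, inscribed in $\Gamma$ and circumscribed about $\gamma$, is an $n$-tuple $(V_1,\dots,V_n)$ of points for which there are lines $\ell_1,\dots,\ell_n$ such that for every $i$ (indices modulo $n$) the line $\ell_i$ meets $\Gamma$ exactly in $V_i$ and $V_{i+1}$, and the tangent lines of $\gamma$ through $V_{i+1}$ are exactly $\ell_i$ and $\ell_{i+1}$ (here $V_i=V_{i+1}$ occurs only when $\ell_i$ is tangent to $\Gamma$, and $\ell_i=\ell_{i+1}$ only when there is just one tangent of $\gamma$ through $V_{i+1}$). Assume that $\gamma,\Gamma$ admit a $1$-parameter family of Poncelet $n$-gons, i.e. for every point $p\in\Gamma$ and every tangent line $\ell$ of $\gamma$ through $p$ there is such a polygon with $V_1=p$ and $\ell_1=\ell$. A Poncelet polygon is called degenerate if for at least one $i$ either $V_i\in\gamma\cap\Gamma$ or the tangent line $T_{V_i}\Gamma$ of $\Gamma$ at $V_i$ is also tangent to $\gamma$. Then: 1. If $P=(V_1,\dots,V_n)$ is a degenerate Poncelet $n$-gon all of whose vertices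 are finite, $V_i=(x_i,y_i)\in\mathbb{C}^2$, then its area vanishes: $A(P)=\frac12\sum_{i=1}^n(x_iy_{i+1}-x_{i+1}y_i)=0$. 2. Suppose that $\gamma$ and $\Gamma$ are in general position, i.e. they intersect transversally: $T_p\gamma\cap T_p\Gamma=\{p\}$ for every $p\in\gamma\cap\Gamma$. Suppose also that the polygons are genuine $n$-gons and not $m$-gons traversed repeatedly, i.e. the assumption on the existence of the family does not hold for any $m$ with $0<m<n$ in place of $n$. Then there are exactly $4n$ distinct degenerate labelled Poncelet $n$-gons (two labelled polygons are equal when $V_i=V_i'$ for all $i$). -/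

import Mathlib

open scoped Matrix

noncomputable section

/-- The complex projective plane. -/
abbrev CP2 : Type := Projectivization ℂ (Fin 3 → ℂ)

/-- Lines of the complex projective plane, as points `[a : b : c]` of the dual plane: the line
`[a : b : c]` is `{[x : y : z] | a * x + b * y + c * z = 0}`. -/
abbrev LineCP2 : Type := Projectivization ℂ (Fin 3 → ℂ)

/-- The point `p` lies on the line `l`. -/
def OnLine (p : CP2) (l : LineCP2) : Prop := Projectivization.orthogonal p l

/-- A smooth conic, given by an invertible symmetric matrix (an equation of the conic). -/
structure Conic where
  mat : Matrix (Fin 3) (Fin 3) ℂ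
  symm : mat.IsSymm
  smooth : IsUnit mat.det

namespace Conic

/-- The points `[v]` with `vᵀ M v = 0`. -/
def points (C : Conic) : Set CP2 := {p | p.rep ⬝ᵥ (C.mat *ᵥ p.rep) = 0}

theorem toLin_injective (C : Conic) : Function.Injective (Matrix.toLin' C.mat) := by
  have h : IsUnit C.mat := (Matrix.isUnit_iff_isUnit_det _).2 C.smooth
  intro v w hvw
  exact Matrix.mulVec_injective_of_isUnit h (by simpa [Matrix.toLin'_apply] using hvw)

/-- For a point `p = [v]` of the conic `vᵀ M v = 0`, the tangent line at `p`. It has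
the coordinates `[M v]` (the gradient of the equation at `v`, up to the factor `2`). -/
def tangentLine (C : Conic) (p : CP2) : LineCP2 :=
  Projectivization.map (Matrix.toLin' C.mat) C.toLin_injective p

/-- The set of all tangent lines of the conic. -/
def tangents (C : Conic) : Set LineCP2 := {l | ∃ p ∈ C.points, C.tangentLine p = l}

end Conic

/-- The two conics intersect transversally: at each common point `p`, the two tangent lines
meet only in `p`. -/
def InGeneralPosition (γ Γ : Conic) : Prop :=
  ∀ p ∈ γ.points ∩ Γ.points,
    {q | OnLine q (γ.tangentLine p) ∧ OnLine q (Γ.tangentLine p)} = {p}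

/-- The closed polygon with vertices `V i` and side lines `l i` (`l i` joins `V i` to `V (i + 1)`)
is produced by the Poncelet construction: the line `l i` meets `Γ` exactly in `V i` and `V (i + 1)`,
and the tangents of `γ` through `V (i + 1)` are exactly `l i` and `l (i + 1)`.
Thus `V i = V (i + 1)` happens only if `l i` is tangent to `Γ`, and `l i = l (i + 1)` only if
there is just one tangent of `γ` through `V (i + 1)`. -/
def IsPonceletChain (γ Γ : Conic) {n : ℕ} (V : ZMod n → CP2) (l : ZMod n → LineCP2) : Prop :=
  ∀ i, {q | q ∈ Γ.points ∧ OnLine q (l i)} = {V i, V (i + 1)} ∧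
    {m | m ∈ γ.tangents ∧ OnLine (V (i + 1)) m} = {l i, l (i + 1)}

/-- A labelled Poncelet `n`-gon `(V i)`, inscribed in `Γ` and circumscribed about `γ`. -/
def IsPonceletPolygon (γ Γ : Conic) {n : ℕ} (V : ZMod n → CP2) : Prop :=
  ∃ l : ZMod n → LineCP2, IsPonceletChain γ Γ V l

/-- The Poncelet construction closes after `n` steps for every choice of a starting vertex
`p` on `Γ` and of a first side `m` (a tangent of `γ` through `p`). -/
def PonceletClosesAfter (γ Γ : Conic) (n : ℕ) : Prop :=
  ∀ p ∈ Γ.points, ∀ m ∈ γ.tangents, OnLine p m →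
    ∃ (V : ZMod n → CP2) (l : ZMod n → LineCP2),
      IsPonceletChain γ Γ V l ∧ V 0 = p ∧ l 0 = m

/-- A vertex lies on both conics, or the tangent of `Γ` at a vertex is also tangent to `γ`. -/
def IsDegeneratePolygon (γ Γ : Conic) {n : ℕ} (V : ZMod n → CP2) : Prop :=
  ∃ i, V i ∈ γ.points ∩ Γ.points ∨ Γ.tangentLine (V i) ∈ γ.tangents

/-- The finite point `[x : y : 1]` of the projective plane. -/
def finitePoint (w : ℂ × ℂ) : CP2 :=
  Projectivization.mk ℂ ![w.1, w.2, 1] (fun h => one_ne_zero (congrFun h 2))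

/-- The signed area of a polygon with vertices in `ℂ²`. -/
def polygonArea {n : ℕ} [NeZero n] (W : ZMod n → ℂ × ℂ) : ℂ :=
  (1 / 2) * ∑ i, ((W i).1 * (W (i + 1)).2 - (W (i + 1)).1 * (W i).2)

end

/-! Area: the Poncelet construction is reversible, and at a degenerate vertex it turns back on
itself. The vertices therefore form a palindrome (`IsPonceletChain.exists_reflection`), and
reversing the order of summation changes the sign of the area. Count: parametrize `Γ` by the
projective line with a common point of the conics at infinity. The chord `xy` touches `γ` iff `x²y²
+ dxy + e(x+y) + f = 0`. For transversal conics this is an elliptic curve whose points are the flags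
(vertex, side), and in Tate normal form one Poncelet step is translation by `t = (0,0)`. So closing
after `n` steps means `n • t = 0`, and minimality makes `n` the order of `t`. The vertex of `P` lies
on `γ` iff `2P = 0`, and the tangent of `Γ` there touches `γ` iff `2P = ±t`; hence the polygon
starting at `P` is degenerate iff `2P` is a multiple of `t`. Each of the `n` multiples has four
halves: root counts give this for `0` and `-t`, translation for the rest. -/

/-! ### Isotropic vectors and tangent lines of a conic. -/

namespace Matrix.IsSymm

theorem dotProduct_mulVec_comm {ι R : Type*} [Fintype ι] [CommRing R] {M : Matrix ι ι R}
    (hM : M.IsSymm) (v w : ι → R) : v ⬝ᵥ (M *ᵥ w) = w ⬝ᵥ (M *ᵥ v) := by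
  rw [Matrix.dotProduct_mulVec, ← Matrix.mulVec_transpose, hM.eq, dotProduct_comm]

/-- A nondegenerate ternary quadratic form has no totally isotropic plane. -/
theorem exists_smul_eq_of_isotropic {M : Matrix (Fin 3) (Fin 3) ℂ} (hM : M.IsSymm)
    (hdet : M.det ≠ 0) {v w : Fin 3 → ℂ} (hv : v ≠ 0) (hvv : v ⬝ᵥ (M *ᵥ v) = 0)
    (hvw : v ⬝ᵥ (M *ᵥ w) = 0) (hww : w ⬝ᵥ (M *ᵥ w) = 0) : ∃ a : ℂ, w = a • v := by
  by_cases hc : crossProduct v w = 0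
  · have h : ¬ LinearIndependent ℂ ![v, w] := fun h =>
      crossProduct_ne_zero_iff_linearIndependent.2 h hc
    rw [LinearIndependent.pair_iff' hv] at h
    push Not at h
    obtain ⟨a, ha⟩ := h
    exact ⟨a, ha.symm⟩
  · exfalso
    obtain ⟨z, hz⟩ : ∃ z : Fin 3 → ℂ, z ⬝ᵥ crossProduct v w ≠ 0 := by
      by_contra! h
      exact hc (dotProduct_eq_zero _ fun z => by rw [dotProduct_comm]; exact h z)
    rw [triple_product_eq_det] at hz
    set P : Matrix (Fin 3) (Fin 3) ℂ := ![z, v, w] with hP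
    -- The Gram matrix of the basis `z, v, w` is congruent to `M`, hence invertible, yet its block
    -- on `v, w` is zero.
    have hG : (P * M * Pᵀ).det ≠ 0 := by
      rw [Matrix.det_mul, Matrix.det_mul, Matrix.det_transpose]
      exact mul_ne_zero (mul_ne_zero hz hdet) hz
    have entry : ∀ i j, (P * M * Pᵀ) i j = P i ⬝ᵥ (M *ᵥ P j) := by
      intro i j
      rw [Matrix.dotProduct_mulVec]
      rfl
    apply hG
    rw [Matrix.det_fin_three]
    simp only [entry]
    have e1 : P 1 = v := rfl
    have e2 : P 2 = w := rfl
    rw [e1, e2, hvv, hvw, hww, dotProduct_mulVec_comm hM w v, hvw]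
    ring

end Matrix.IsSymm

namespace Conic

variable (C : Conic)

theorem det_ne_zero : C.mat.det ≠ 0 := C.smooth.ne_zero

theorem mulVec_ne_zero {v : Fin 3 → ℂ} (hv : v ≠ 0) : C.mat *ᵥ v ≠ 0 := fun h =>
  hv (C.toLin_injective (by simpa [Matrix.toLin'_apply] using h))

theorem mk_mem_points {v : Fin 3 → ℂ} (hv : v ≠ 0) :
    Projectivization.mk ℂ v hv ∈ C.points ↔ v ⬝ᵥ (C.mat *ᵥ v) = 0 := by
  obtain ⟨a, ha⟩ := Projectivization.exists_smul_eq_mk_rep ℂ v hv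
  have ha0 : (a : ℂ) ≠ 0 := a.ne_zero
  change (Projectivization.mk ℂ v hv).rep ⬝ᵥ (C.mat *ᵥ (Projectivization.mk ℂ v hv).rep) = 0 ↔ _
  rw [← ha, Units.smul_def, Matrix.mulVec_smul, smul_dotProduct, dotProduct_smul]
  simp [ha0]

theorem tangentLine_mk {v : Fin 3 → ℂ} (hv : v ≠ 0) :
    C.tangentLine (Projectivization.mk ℂ v hv)
      = Projectivization.mk ℂ (C.mat *ᵥ v) (C.mulVec_ne_zero hv) := rfl

/-- Two distinct points would span a totally isotropic plane. -/
theorem eq_of_onLine_tangentLine {p q : CP2} (hp : p ∈ C.points) (hq : q ∈ C.points)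
    (h : OnLine q (C.tangentLine p)) : q = p := by
  induction p using Projectivization.ind with | h v hv
  induction q using Projectivization.ind with | h w hw
  rw [mk_mem_points] at hp hq
  rw [tangentLine_mk, OnLine, Projectivization.orthogonal_mk] at h
  rw [C.symm.dotProduct_mulVec_comm] at h
  obtain ⟨a, ha⟩ := C.symm.exists_smul_eq_of_isotropic C.det_ne_zero hv hp h hq
  exact (Projectivization.mk_eq_mk_iff' ℂ _ _ _ _).2 ⟨a, ha.symm⟩

theorem eq_tangentLine_of_mem {p : CP2} (hp : p ∈ C.points) {l : LineCP2} (hl : l ∈ C.tangents)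
    (h : OnLine p l) : l = C.tangentLine p := by
  obtain ⟨q, hq, rfl⟩ := hl
  rw [C.eq_of_onLine_tangentLine hq hp h]

theorem onLine_tangentLine {p : CP2} (hp : p ∈ C.points) : OnLine p (C.tangentLine p) := by
  induction p using Projectivization.ind with | h v hv
  rw [mk_mem_points] at hp
  rwa [tangentLine_mk, OnLine, Projectivization.orthogonal_mk]

end Conic

/-! ### Degenerate polygons are palindromes; vanishing of the area. -/

theorem finitePoint_injective : Function.Injective finitePoint := by
  rintro ⟨x, y⟩ ⟨x', y'⟩ h
  obtain ⟨a, ha⟩ := (Projectivization.mk_eq_mk_iff' ℂ _ _ _ _).1 h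
  have h0 := congrFun ha 0
  have h1 := congrFun ha 1
  have h2 := congrFun ha 2
  simp at h0 h1 h2
  subst h2
  simp [← h0, ← h1]

/-- This makes the construction deterministic: the pair and one member fix the other, even when the
two coincide. -/
theorem Set.pair_left_cancel {α : Type*} {a b c : α} (h : ({a, b} : Set α) = {a, c}) : b = c := by
  rcases Set.pair_eq_pair_iff.1 h with ⟨-, h⟩ | ⟨h, h'⟩
  · exact h
  · exact h'.trans h

namespace IsPonceletChain

variable {γ Γ : Conic} {n : ℕ} {V : ZMod n → CP2} {l : ZMod n → LineCP2}

theorem mem_points (h : IsPonceletChain γ Γ V l) (i : ZMod n) : V i ∈ Γ.points := by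
  have : V i ∈ ({V i, V (i + 1)} : Set CP2) := Set.mem_insert _ _
  rw [← (h i).1] at this
  exact this.1

theorem onLine (h : IsPonceletChain γ Γ V l) (i : ZMod n) : OnLine (V i) (l i) := by
  have : V i ∈ ({V i, V (i + 1)} : Set CP2) := Set.mem_insert _ _
  rw [← (h i).1] at this
  exact this.2

theorem mem_tangents (h : IsPonceletChain γ Γ V l) (i : ZMod n) : l i ∈ γ.tangents := by
  have : l i ∈ ({l i, l (i + 1)} : Set LineCP2) := Set.mem_insert _ _
  rw [← (h i).2] at this
  exact this.1

/-- The reversed chain obeys the same rules, so agreement at one flag propagates. Since `l i` joins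
`V i` to `V (i + 1)`, the reflection `c - i` of vertices acts on sides as `c - 1 - i`. -/
theorem reflect (h : IsPonceletChain γ Γ V l) {c i : ZMod n} (hV : V (c - i) = V i)
    (hl : l (c - 1 - i) = l i) : ∀ k : ℕ, V (c - (i + k)) = V (i + k) ∧
      l (c - 1 - (i + k)) = l (i + k) := by
  intro k
  induction k with
  | zero => simpa using ⟨hV, hl⟩
  | succ k ih =>
    obtain ⟨ihV, ihl⟩ := ih
    have e1 : i + ((k + 1 : ℕ) : ZMod n) = i + k + 1 := by push_cast; ring
    rw [e1]
    set j := i + (k : ZMod n)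
    have a : V (c - (j + 1)) = V (j + 1) := by
      have h1 := (h (c - 1 - j)).1
      rw [ihl, (h j).1, show c - 1 - j + 1 = c - j by ring, ihV, Set.pair_comm _ (V j),
        show c - 1 - j = c - (j + 1) by ring] at h1
      exact (Set.pair_left_cancel h1).symm
    refine ⟨a, ?_⟩
    have h2 := (h (c - 1 - (j + 1))).2
    rw [show c - 1 - (j + 1) + 1 = c - (j + 1) by ring, a, (h j).2,
      show c - (j + 1) = c - 1 - j by ring, ihl, Set.pair_comm _ (l j)] at h2
    exact (Set.pair_left_cancel h2).symm

/-- The vertices of a degenerate polygon form a palindromic sequence. -/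
theorem exists_reflection [NeZero n] (h : IsPonceletChain γ Γ V l)
    (hd : IsDegeneratePolygon γ Γ V) : ∃ c : ZMod n, ∀ i, V (c - i) = V i := by
  obtain ⟨c, i, hV, hl⟩ : ∃ c i : ZMod n, V (c - i) = V i ∧ l (c - 1 - i) = l i := by
    obtain ⟨i, hi | hi⟩ := hd
    -- A vertex on `γ` has only one tangent, so both sides there agree and the reflection is centred
    -- at `i`.
    · refine ⟨i + i, i, by ring_nf, ?_⟩
      rw [show i + i - 1 - i = i - 1 by ring]
      have h1 : l (i - 1) ∈ {m | m ∈ γ.tangents ∧ OnLine (V (i - 1 + 1)) m} := by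
        rw [(h (i - 1)).2]; simp
      rw [sub_add_cancel] at h1
      rw [γ.eq_tangentLine_of_mem hi.1 (h.mem_tangents i) (h.onLine i),
        γ.eq_tangentLine_of_mem hi.1 h1.1 h1.2]
    -- Here the tangent of `Γ` is one of the two sides at `V i`. The endpoints of that side
    -- coincide, and the reflection is centred at its midpoint.
    · have hp := h.mem_points i
      have h1 : Γ.tangentLine (V i) ∈ {m | m ∈ γ.tangents ∧ OnLine (V (i - 1 + 1)) m} := by
        rw [sub_add_cancel]
        exact ⟨hi, Γ.onLine_tangentLine hp⟩
      have key : ∀ j, Γ.tangentLine (V i) = l j → V j = V i ∧ V (j + 1) = V i := by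
        intro j hj
        have hj' := (h j).1
        constructor
        · have : V j ∈ {q | q ∈ Γ.points ∧ OnLine q (l j)} := by rw [hj']; simp
          rw [← hj] at this
          exact Γ.eq_of_onLine_tangentLine hp this.1 this.2
        · have : V (j + 1) ∈ {q | q ∈ Γ.points ∧ OnLine q (l j)} := by rw [hj']; simp
          rw [← hj] at this
          exact Γ.eq_of_onLine_tangentLine hp this.1 this.2
      rw [(h (i - 1)).2, sub_add_cancel] at h1
      rcases h1 with h1 | h1
      · refine ⟨i + (i - 1), i - 1, ?_, ?_⟩
        · rw [add_sub_cancel_right]; exact (key _ h1).1.symm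
        · congr 1; ring
      · refine ⟨i + i + 1, i, ?_, ?_⟩
        · rw [show i + i + 1 - i = i + 1 by ring]; exact (key _ h1).2
        · congr 1; ring
  refine ⟨c, fun j => ?_⟩
  have := (h.reflect hV hl (j - i).val).1
  rwa [ZMod.natCast_zmod_val, add_sub_cancel] at this

end IsPonceletChain

/-- Reindexing by `c - 1 - i` swaps the endpoints of every edge, so the sum equals its negative. -/
theorem polygonArea_eq_zero_of_reflection {n : ℕ} [NeZero n] {W : ZMod n → ℂ × ℂ} {c : ZMod n}
    (h : ∀ i, W (c - i) = W i) : polygonArea W = 0 := by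
  have key : ∑ i, ((W i).1 * (W (i + 1)).2 - (W (i + 1)).1 * (W i).2)
      = - ∑ i, ((W i).1 * (W (i + 1)).2 - (W (i + 1)).1 * (W i).2) := by
    conv_lhs => rw [← Equiv.sum_comp (Equiv.subLeft (c - 1))]
    rw [← Finset.sum_neg_distrib]
    refine Finset.sum_congr rfl fun i _ => ?_
    rw [Equiv.subLeft_apply, show c - 1 - i + 1 = c - i by ring,
      show c - 1 - i = c - (i + 1) by ring, h, h]
    ring
  rw [polygonArea, self_eq_neg.1 key, mul_zero]

theorem polygonArea_eq_zero {γ Γ : Conic} {n : ℕ} [NeZero n] {W : ZMod n → ℂ × ℂ}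
    (hW : IsPonceletPolygon γ Γ (fun i => finitePoint (W i)))
    (hd : IsDegeneratePolygon γ Γ (fun i => finitePoint (W i))) : polygonArea W = 0 := by
  obtain ⟨l, hl⟩ := hW
  obtain ⟨c, hc⟩ := hl.exists_reflection hd
  exact polygonArea_eq_zero_of_reflection fun i => finitePoint_injective (hc i)

/-! ### The biquadratic curve and its Tate normal form. -/

/-- The vanishing of the biquadratic form `x² y² + d x y + e (x + y) + f` on `ℙ¹ × ℙ¹`, where
`ℙ¹` is `ℂ` together with the point `none` at infinity. -/
def Biquadratic (d e f : ℂ) : Option ℂ → Option ℂ → Prop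
  | some x, some y => x ^ 2 * y ^ 2 + d * x * y + e * (x + y) + f = 0
  | none, some y => y = 0
  | some x, none => x = 0
  | none, none => False

/-- The leading coefficient `-4 e` of the discriminant of the biquadratic form does not vanish and
the discriminant has no double roots; this makes the biquadratic curve nonsingular. -/
structure BiquadraticSmooth (d e f : ℂ) : Prop where
  e_ne_zero : e ≠ 0
  no_double_root : ∀ x, (d * x + e) ^ 2 - 4 * x ^ 2 * (e * x + f) = 0 →
    2 * d * (d * x + e) - 8 * x * (e * x + f) - 4 * e * x ^ 2 ≠ 0

/-- The Weierstrass curve in Tate normal form which is isomorphic to the biquadratic curve. -/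
noncomputable abbrev tateCurve (d e f : ℂ) : WeierstrassCurve.Affine ℂ := ⟨-d, -f, e ^ 2, 0, 0⟩

/-- The first coordinate of the point of the biquadratic curve given by a point of its
Tate normal form. -/
noncomputable def firstCoord {d e f : ℂ} : (tateCurve d e f).Point → Option ℂ
  | .zero => none
  | .some X _ _ => some (-X / e)

theorem Biquadratic.symm {d e f : ℂ} {a b : Option ℂ} (h : Biquadratic d e f a b) :
    Biquadratic d e f b a := by
  rcases a with _ | x <;> rcases b with _ | y
  · exact h
  · exact h
  · exact h
  · have : x ^ 2 * y ^ 2 + d * x * y + e * (x + y) + f = 0 := h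
    change y ^ 2 * x ^ 2 + d * y * x + e * (y + x) + f = 0
    linear_combination this

theorem tateCurve_equation {d e f X U : ℂ} :
    (tateCurve d e f).Equation X U ↔ U ^ 2 - d * X * U + e ^ 2 * U = X ^ 3 - f * X ^ 2 := by
  rw [WeierstrassCurve.Affine.equation_iff]
  simp only [neg_mul, zero_mul, add_zero, ← sub_eq_add_neg]

theorem firstCoord_neg {d e f : ℂ} (P : (tateCurve d e f).Point) :
    firstCoord (-P) = firstCoord P := by
  rcases P with _ | ⟨X, U, h⟩ <;> rfl

namespace BiquadraticSmooth

variable {d e f : ℂ} (H : BiquadraticSmooth d e f)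
include H

/-- The quartic `x⁴ + d x² + 2 e x + f` has no double roots. -/
theorem diagonal_no_double_root {x : ℂ} (h : x ^ 4 + d * x ^ 2 + 2 * e * x + f = 0) :
    4 * x ^ 3 + 2 * d * x + 2 * e ≠ 0 := by
  intro h'
  -- Solving for `e` and `f` gives `d x + e = -2x³` and `e x + f = x⁴`, so `x` is also a double root
  -- of the discriminant.
  have he : e = -2 * x ^ 3 - d * x := by linear_combination h' / 2
  have hf : f = 3 * x ^ 4 + d * x ^ 2 := by rw [he] at h; linear_combination h
  refine H.no_double_root x ?_ ?_ <;> rw [hf, he] <;> ring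

/-- The parameter is the `X`-coordinate up to the factor `-1/e`, so its fibres are the orbits of
negation. -/
theorem firstCoord_eq_iff {P P' : (tateCurve d e f).Point} :
    firstCoord P' = firstCoord P ↔ P' = P ∨ P' = -P := by
  refine ⟨fun h => ?_, ?_⟩
  · rcases P with _ | ⟨X, U, hP⟩ <;> rcases P' with _ | ⟨X', U', hP'⟩
    · exact Or.inl rfl
    · cases h
    · cases h
    · have hX : X' = X := by
        have := H.e_ne_zero
        simpa [firstCoord, neg_div, div_left_inj' this] using h
      subst hX
      rw [WeierstrassCurve.Affine.Point.neg_some]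
      rcases WeierstrassCurve.Affine.Y_eq_of_X_eq hP'.1 hP.1 rfl with hU | hU
      · subst hU; exact Or.inl rfl
      · subst hU; exact Or.inr rfl
  · rintro (rfl | rfl)
    · rfl
    · exact firstCoord_neg P

theorem nonsingular_zero : (tateCurve d e f).Nonsingular 0 0 := by
  rw [WeierstrassCurve.Affine.nonsingular_iff, tateCurve_equation]
  refine ⟨by ring, Or.inr ?_⟩
  simpa using H.e_ne_zero

/-- The point of the Tate normal form by which the Poncelet construction translates. -/
def shift : (tateCurve d e f).Point := .some 0 0 H.nonsingular_zero

/-- The substitution `X = -e x`, `U = e x² y` turns the Weierstrass equation into `e² x²` times the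
biquadratic one. A singular image has `x ≠ 0` and kills both partial derivatives of the biquadratic
form; their difference factors, giving a double root on the diagonal or `e = 0`. -/
theorem nonsingular {x y : ℂ} (h : Biquadratic d e f (some x) (some y)) :
    (tateCurve d e f).Nonsingular (-e * x) (e * x ^ 2 * y) := by
  have hQ : x ^ 2 * y ^ 2 + d * x * y + e * (x + y) + f = 0 := h
  have he := H.e_ne_zero
  rw [WeierstrassCurve.Affine.nonsingular_iff, tateCurve_equation]
  refine ⟨by linear_combination e ^ 2 * x ^ 2 * hQ, ?_⟩
  by_contra! hs
  obtain ⟨h1, h2⟩ := hs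
  simp only at h1 h2
  have hx : x ≠ 0 := by
    rintro rfl
    apply he
    have : e ^ 2 = 0 := by linear_combination h2
    exact pow_eq_zero_iff two_ne_zero |>.1 this
  have hy' : 2 * x ^ 2 * y + d * x + e = 0 := by
    refine (mul_eq_zero.1 (?_ : e * _ = 0)).resolve_left he
    linear_combination h2
  have hx' : 2 * x * y ^ 2 + d * y + e = 0 := by
    refine (mul_eq_zero.1 (?_ : (e ^ 2 * x ^ 2) * _ = 0)).resolve_left
      (mul_ne_zero (pow_ne_zero _ he) (pow_ne_zero _ hx))
    linear_combination -e * h1 + (2 * e ^ 2 * x * y) * hy' - 2 * e ^ 2 * x * hQ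
  have hxy : (y - x) * (2 * x * y + d) = 0 := by linear_combination hx' - hy'
  rcases mul_eq_zero.1 hxy with h3 | h3
  · obtain rfl : y = x := sub_eq_zero.1 h3
    exact H.diagonal_no_double_root (x := y) (by linear_combination hQ)
      (by linear_combination 2 * hy')
  · exact he (by linear_combination hy' - x * h3)

theorem firstCoord_add_shift_of_ne {X U : ℂ} (h : (tateCurve d e f).Nonsingular X U)
    (hX : X ≠ 0) :
    firstCoord (.some X U h + H.shift) = some (-((U / X) ^ 2 - d * (U / X) + f - X) / e) := by
  rw [shift, WeierstrassCurve.Affine.Point.add_of_X_ne hX]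
  simp only [firstCoord, WeierstrassCurve.Affine.slope_of_X_ne hX, WeierstrassCurve.Affine.addX,
    sub_zero]
  congr 3
  ring

theorem firstCoord_shift_add_shift : firstCoord (H.shift + H.shift) = some (-f / e) := by
  have hY : (0 : ℂ) ≠ (tateCurve d e f).negY 0 0 := by
    simpa [WeierstrassCurve.Affine.negY] using H.e_ne_zero
  rw [shift, WeierstrassCurve.Affine.Point.add_self_of_Y_ne hY]
  simp [firstCoord, WeierstrassCurve.Affine.slope_of_Y_ne rfl hY, WeierstrassCurve.Affine.addX]

theorem eq_shift_or {U : ℂ} (h : (tateCurve d e f).Nonsingular 0 U) :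
    WeierstrassCurve.Affine.Point.some 0 U h = H.shift ∨
      WeierstrassCurve.Affine.Point.some 0 U h = -H.shift := by
  apply H.firstCoord_eq_iff.1
  simp [firstCoord, shift]

/-- Here the Poncelet step becomes a translation. For `X ≠ 0` the chord through `(0,0)` has slope `U
/ X`, and the addition formula gives `P + shift` the parameter `e U / X²`, which is the `y` of the
substitution. Zero and the points with `X = 0` are checked separately. -/
theorem biquadratic_firstCoord (P : (tateCurve d e f).Point) :
    Biquadratic d e f (firstCoord P) (firstCoord (P + H.shift)) := by
  have he := H.e_ne_zero
  rcases P with _ | ⟨X, U, h⟩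
  · change Biquadratic d e f none (firstCoord (0 + H.shift))
    rw [zero_add]
    change -0 / e = 0
    simp
  · by_cases hX : X = 0
    · subst hX
      rcases H.eq_shift_or h with h' | h'
      · rw [h', H.firstCoord_shift_add_shift]
        change (-0 / e) ^ 2 * (-f / e) ^ 2 + d * (-0 / e) * (-f / e) + e * (-0 / e + -f / e) + f = 0
        field_simp
        ring
      · rw [h', neg_add_cancel]
        change -0 / e = 0
        simp
    · rw [H.firstCoord_add_shift_of_ne h hX]
      have hE := tateCurve_equation.1 h.1
      have hE' : (U / X) ^ 2 - d * (U / X) + f - X = - e ^ 2 * U / X ^ 2 := by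
        field_simp
        linear_combination hE
      rw [hE']
      change (-X / e) ^ 2 * (-(- e ^ 2 * U / X ^ 2) / e) ^ 2 +
        d * (-X / e) * (-(- e ^ 2 * U / X ^ 2) / e) + e * (-X / e + (-(- e ^ 2 * U / X ^ 2) / e))
          + f = 0
      field_simp
      linear_combination hE

/-- The points missed by the affine substitution are `0` over `(∞, 0)` and `-shift` over `(0, ∞)`.
-/
theorem exists_point {a b : Option ℂ} (h : Biquadratic d e f a b) :
    ∃ P : (tateCurve d e f).Point, firstCoord P = a ∧ firstCoord (P + H.shift) = b := by
  have he := H.e_ne_zero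
  rcases a with _ | x <;> rcases b with _ | y
  · exact h.elim
  · obtain rfl : y = 0 := h
    refine ⟨0, rfl, ?_⟩
    rw [zero_add]
    simp [shift, firstCoord]
  · obtain rfl : x = 0 := h
    refine ⟨-H.shift, ?_, ?_⟩
    · rw [firstCoord_neg]
      simp [shift, firstCoord]
    · rw [neg_add_cancel]
      rfl
  · refine ⟨.some _ _ (H.nonsingular h), ?_, ?_⟩
    · simp only [firstCoord]
      congr 1
      field_simp
    · have hQ : x ^ 2 * y ^ 2 + d * x * y + e * (x + y) + f = 0 := h
      by_cases hx : x = 0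
      · subst hx
        have : WeierstrassCurve.Affine.Point.some _ _ (H.nonsingular h) = H.shift := by
          simp [shift]
        rw [this, H.firstCoord_shift_add_shift]
        congr 1
        field_simp
        linear_combination -hQ
      · rw [H.firstCoord_add_shift_of_ne _ (mul_ne_zero (neg_ne_zero.2 he) hx)]
        congr 1
        field_simp
        linear_combination -hQ

theorem shift_ne_neg_shift : H.shift ≠ -H.shift := by
  rw [shift, WeierstrassCurve.Affine.Point.neg_some]
  intro h
  rw [WeierstrassCurve.Affine.Point.some.injEq] at h
  exact H.e_ne_zero (by simpa [WeierstrassCurve.Affine.negY] using h.2)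

/-- If the sign flipped at both parameters, `shift` would equal its negative. -/
theorem eq_of_firstCoord_eq {P P' : (tateCurve d e f).Point} (h : firstCoord P' = firstCoord P)
    (h' : firstCoord (P' + H.shift) = firstCoord (P + H.shift)) : P' = P := by
  rcases H.firstCoord_eq_iff.1 h with h | h
  · exact h
  · rcases H.firstCoord_eq_iff.1 h' with h' | h'
    · exact add_right_cancel h'
    · exfalso
      apply H.shift_ne_neg_shift
      rw [h, neg_add] at h'
      exact add_left_cancel h'

end BiquadraticSmooth

/-! ### Counting halves in an abelian group. -/

/-- Translation by `j • t` changes doubles by `2j • t`, so only the parity of `k` matters. -/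
theorem ncard_add_self_eq_zsmul {G : Type*} [AddCommGroup G] {t : G}
    (h0 : {P : G | P + P = 0}.ncard = 4) (h1 : {P : G | P + P = -t}.ncard = 4) (k : ℤ) :
    {P : G | P + P = k • t}.ncard = 4 := by
  obtain ⟨j, rfl | rfl⟩ := Int.even_or_odd' k
  · have : {P : G | P + P = (2 * j) • t} = (fun P => P + j • t) '' {P : G | P + P = 0} := by
      ext P
      simp only [Set.mem_ofPred_eq, Set.mem_image]
      constructor
      · intro h
        refine ⟨P - j • t, ?_, by abel⟩
        rw [sub_add_sub_comm, h, two_mul, add_smul, sub_self]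
      · rintro ⟨Q, hQ, rfl⟩
        rw [add_add_add_comm, hQ, zero_add, two_mul, add_smul]
    rw [this, Set.ncard_image_of_injective _ (add_left_injective _), h0]
  · have : {P : G | P + P = (2 * j + 1) • t}
        = (fun P => P + (j + 1) • t) '' {P : G | P + P = -t} := by
      ext P
      simp only [Set.mem_ofPred_eq, Set.mem_image]
      constructor
      · intro h
        refine ⟨P - (j + 1) • t, ?_, by abel⟩
        rw [sub_add_sub_comm, h]
        module
      · rintro ⟨Q, hQ, rfl⟩
        rw [add_add_add_comm, hQ]
        module
    rw [this, Set.ncard_image_of_injective _ (add_left_injective _), h1]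

/-- The number of points whose double is a multiple of `t`. -/
theorem ncard_add_self_mem_zmultiples {G : Type*} [AddCommGroup G] {t : G} {n : ℕ} (hn : 0 < n)
    (ht : addOrderOf t = n) (h0 : {P : G | P + P = 0}.ncard = 4)
    (h1 : {P : G | P + P = -t}.ncard = 4) : {P : G | ∃ k : ℤ, P + P = k • t}.ncard = 4 * n := by
  classical
  have hcard : ∀ k : ℕ, {P : G | P + P = k • t}.ncard = 4 := fun k => by
    simpa using ncard_add_self_eq_zsmul h0 h1 (k : ℤ)
  have hfin : ∀ k : ℕ, {P : G | P + P = k • t}.Finite := fun k =>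
    Set.finite_of_ncard_ne_zero (by rw [hcard]; norm_num)
  -- As `t` has order `n`, the multiples `k • t` with `k < n` are distinct and exhaust all, and the
  -- sets of halves are disjoint.
  have key : {P : G | ∃ k : ℤ, P + P = k • t}
      = ((Finset.range n).biUnion fun k => (hfin k).toFinset : Finset G) := by
    ext P
    simp only [Set.mem_ofPred_eq, Finset.coe_biUnion, Set.mem_iUnion, Finset.mem_coe,
      Finset.mem_range, Set.Finite.mem_toFinset, exists_prop]
    constructor
    · rintro ⟨k, hk⟩
      have hpos : (0 : ℤ) < n := by exact_mod_cast hn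
      refine ⟨(k % n).toNat, ?_, ?_⟩
      · have := Int.emod_lt_of_pos k hpos
        omega
      · rw [hk, ← natCast_zsmul, Int.toNat_of_nonneg (Int.emod_nonneg _ hpos.ne'), ← ht,
          mod_addOrderOf_zsmul]
    · rintro ⟨k, -, hk⟩
      exact ⟨k, by simpa using hk⟩
  rw [key, Set.ncard_coe_finset, Finset.card_biUnion]
  · rw [Finset.sum_congr rfl fun k _ => (Set.ncard_eq_toFinset_card _ (hfin k)).symm.trans (hcard k)]
    simp [mul_comm]
  · intro i hi j hj hij
    rw [Function.onFun, Finset.disjoint_left]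
    intro P hP hP'
    rw [Set.Finite.mem_toFinset, Set.mem_ofPred_eq] at hP hP'
    refine hij (nsmul_injOn_Iio_addOrderOf ?_ ?_ (hP.symm.trans hP'))
    · rw [ht]; exact Finset.mem_range.1 hi
    · rw [ht]; exact Finset.mem_range.1 hj

/-! ### The Poncelet construction as a translation. -/

/-- Coordinates adapted to a common point of the two conics: `Γ` is parametrized by the projective
line, lines are unordered pairs of points of `Γ`, and tangency to `γ` is the vanishing of a
biquadratic form. -/
structure NormalForm (γ Γ : Conic) where
  d : ℂ
  e : ℂ
  f : ℂ
  smooth : BiquadraticSmooth d e f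
  point : Option ℂ → CP2
  line : Option ℂ → Option ℂ → LineCP2
  point_injective : Function.Injective point
  mem_points_iff : ∀ p, p ∈ Γ.points ↔ ∃ x, point x = p
  exists_line : ∀ m, ∃ x y, line x y = m
  line_comm : ∀ x y, line x y = line y x
  onLine_iff : ∀ t x y, OnLine (point t) (line x y) ↔ t = x ∨ t = y
  line_mem_tangents : ∀ x y, line x y ∈ γ.tangents ↔ Biquadratic d e f x y
  tangentLine_point : ∀ x, Γ.tangentLine (point x) = line x x
  point_mem_iff : ∀ x, point x ∈ γ.points ↔
    ∀ z, x = some z → (d * z + e) ^ 2 - 4 * z ^ 2 * (e * z + f) = 0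

namespace NormalForm

variable {γ Γ : Conic} (N : NormalForm γ Γ)

/-- The group of the Tate normal form. -/
abbrev Pt : Type := (tateCurve N.d N.e N.f).Point

/-- The translation of the Poncelet construction. -/
abbrev t : N.Pt := N.smooth.shift

theorem line_eq_iff {x y x' y' : Option ℂ} :
    N.line x y = N.line x' y' ↔ x = x' ∧ y = y' ∨ x = y' ∧ y = x' := by
  refine ⟨fun h => ?_, ?_⟩
  · rw [← Set.pair_eq_pair_iff]
    ext s
    simp only [Set.mem_insert_iff, Set.mem_singleton_iff]
    rw [← N.onLine_iff, ← N.onLine_iff, h]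
  · rintro (⟨rfl, rfl⟩ | ⟨rfl, rfl⟩)
    · rfl
    · exact N.line_comm _ _

theorem points_on_line (x y : Option ℂ) :
    {q | q ∈ Γ.points ∧ OnLine q (N.line x y)} = {N.point x, N.point y} := by
  ext q
  simp only [Set.mem_ofPred_eq, Set.mem_insert_iff, Set.mem_singleton_iff, N.mem_points_iff]
  constructor
  · rintro ⟨⟨s, rfl⟩, h⟩
    rcases (N.onLine_iff _ _ _).1 h with rfl | rfl <;> simp
  · rintro (rfl | rfl)
    · exact ⟨⟨_, rfl⟩, (N.onLine_iff _ _ _).2 (Or.inl rfl)⟩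
    · exact ⟨⟨_, rfl⟩, (N.onLine_iff _ _ _).2 (Or.inr rfl)⟩

/-- The tangent of `γ` belonging to a point of the group. -/
noncomputable def side (P : N.Pt) : LineCP2 := N.line (firstCoord P) (firstCoord (P + N.t))

/-- The involution `P ↦ -(P + t)` keeps the side and exchanges its endpoints; `P ↦ -P` keeps the
vertex. Their composite is the Poncelet step. -/
theorem side_neg_add (P : N.Pt) : N.side (-(P + N.t)) = N.side P := by
  have : -(P + N.t) + N.t = -P := by abel
  rw [side, this, firstCoord_neg, firstCoord_neg, N.line_comm, side]

theorem side_mem_tangents (P : N.Pt) : N.side P ∈ γ.tangents :=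
  (N.line_mem_tangents _ _).2 (N.smooth.biquadratic_firstCoord P)

theorem eq_of_side_eq {P P' : N.Pt} (h : firstCoord P = firstCoord P') (hs : N.side P = N.side P') :
    P = P' := by
  refine N.smooth.eq_of_firstCoord_eq h ?_
  rcases N.line_eq_iff.1 hs with ⟨-, h'⟩ | ⟨h', h''⟩
  · exact h'
  · exact h''.trans (h.symm.trans h')

theorem tangents_through (P : N.Pt) :
    {m | m ∈ γ.tangents ∧ OnLine (N.point (firstCoord P)) m} = {N.side P, N.side (-P)} := by
  ext m
  simp only [Set.mem_ofPred_eq, Set.mem_insert_iff, Set.mem_singleton_iff]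
  constructor
  · rintro ⟨hm, ho⟩
    obtain ⟨b, rfl⟩ : ∃ b, N.line (firstCoord P) b = m := by
      obtain ⟨x, y, rfl⟩ := N.exists_line m
      rcases (N.onLine_iff _ _ _).1 ho with h | h
      · exact ⟨y, by rw [h]⟩
      · exact ⟨x, by rw [h, N.line_comm]⟩
    obtain ⟨R, hR, rfl⟩ := N.smooth.exists_point ((N.line_mem_tangents _ _).1 hm)
    rw [← hR]
    rcases N.smooth.firstCoord_eq_iff.1 hR with rfl | rfl
    · exact Or.inl rfl
    · exact Or.inr rfl
  · rintro (rfl | rfl)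
    · exact ⟨N.side_mem_tangents _, (N.onLine_iff _ _ _).2 (Or.inl rfl)⟩
    · exact ⟨N.side_mem_tangents _, (N.onLine_iff _ _ _).2 (Or.inl (firstCoord_neg P).symm)⟩

theorem isPonceletChain {n : ℕ} {φ : ZMod n →+ N.Pt} (hφ : φ 1 = N.t) (P : N.Pt) :
    IsPonceletChain γ Γ (fun i => N.point (firstCoord (P + φ i))) (fun i => N.side (P + φ i)) := by
  intro i
  have h : P + φ (i + 1) = P + φ i + N.t := by rw [map_add, hφ, add_assoc]
  refine ⟨?_, ?_⟩
  · simp only [h]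
    exact N.points_on_line _ _
  · simp only [h]
    rw [N.tangents_through, N.side_neg_add, Set.pair_comm]

/-- Each flag lifts to a unique point, and determinism of the construction forces consecutive lifts
to differ by `t`. -/
theorem exists_of_isPonceletChain {n : ℕ} {V : ZMod n → CP2} {l : ZMod n → LineCP2}
    (h : IsPonceletChain γ Γ V l) : ∃ P : ZMod n → N.Pt, (∀ i, P (i + 1) = P i + N.t) ∧
      ∀ i, V i = N.point (firstCoord (P i)) := by
  have step : ∀ i, ∃ P : N.Pt, V i = N.point (firstCoord P) ∧ l i = N.side P := by
    intro i
    obtain ⟨x, hx⟩ := (N.mem_points_iff _).1 (h.mem_points i)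
    have hm : l i ∈ {m | m ∈ γ.tangents ∧ OnLine (V i) m} := ⟨h.mem_tangents i, h.onLine i⟩
    obtain ⟨a, b, hab⟩ := N.exists_line (l i)
    obtain ⟨y, hy⟩ : ∃ y, N.line x y = l i := by
      have := h.onLine i
      rw [← hx, ← hab, N.onLine_iff] at this
      rcases this with rfl | rfl
      · exact ⟨_, hab⟩
      · exact ⟨_, (N.line_comm _ _).trans hab⟩
    obtain ⟨P, rfl, rfl⟩ := N.smooth.exists_point
      ((N.line_mem_tangents x y).1 (hy ▸ h.mem_tangents i))
    exact ⟨P, hx.symm, hy.symm⟩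
  choose P hV hl using step
  refine ⟨P, fun i => ?_, hV⟩
  have h1 := (h i).1
  rw [hl, side, N.points_on_line, ← hV i] at h1
  have h2 := Set.pair_left_cancel h1
  rw [hV (i + 1)] at h2
  have h3 := N.point_injective h2
  have h4 := (h i).2
  rw [hV (i + 1), ← h3, N.tangents_through, Set.pair_comm,
    N.side_neg_add, ← hl i] at h4
  have h5 := Set.pair_left_cancel h4
  rw [hl] at h5
  exact (N.eq_of_side_eq h3 h5).symm

theorem nsmul_t_eq_zero_of_closes {n : ℕ} (h : PonceletClosesAfter γ Γ n) : n • N.t = 0 := by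
  obtain ⟨V, l, hc, -⟩ := h (N.point (firstCoord (0 : N.Pt))) ((N.mem_points_iff _).2 ⟨_, rfl⟩)
    (N.side 0) (N.side_mem_tangents 0) ((N.onLine_iff _ _ _).2 (Or.inl rfl))
  obtain ⟨P, hP, -⟩ := N.exists_of_isPonceletChain hc
  have key : ∀ k : ℕ, P k = P 0 + k • N.t := by
    intro k
    induction k with
    | zero => simp
    | succ k ih => rw [Nat.cast_succ, hP, ih, succ_nsmul, add_assoc]
  have := key n
  rw [ZMod.natCast_self] at this
  exact left_eq_add.1 this

/-- The homomorphism `i ↦ i • t`. -/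
theorem exists_addMonoidHom {n : ℕ} (h : n • N.t = 0) : ∃ φ : ZMod n →+ N.Pt, φ 1 = N.t := by
  refine ⟨ZMod.lift n ⟨zmultiplesHom _ N.t, by simpa using h⟩, ?_⟩
  have := ZMod.lift_coe n (⟨zmultiplesHom _ N.t, by simpa using h⟩ :
    { f : ℤ →+ N.Pt // f n = 0 }) 1
  simpa using this

/-- Poncelet's porism: closing depends on `t` alone. It also turns minimality of `n` into a
statement about the order of `t`. -/
theorem closes_of_nsmul_t_eq_zero {n : ℕ} (h : n • N.t = 0) : PonceletClosesAfter γ Γ n := by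
  obtain ⟨φ, hφ⟩ := N.exists_addMonoidHom h
  intro p hp m hm ho
  obtain ⟨x, rfl⟩ := (N.mem_points_iff _).1 hp
  obtain ⟨y, rfl⟩ : ∃ y, N.line x y = m := by
    obtain ⟨a, b, rfl⟩ := N.exists_line m
    rcases (N.onLine_iff _ _ _).1 ho with rfl | rfl
    · exact ⟨_, rfl⟩
    · exact ⟨_, N.line_comm _ _⟩
  obtain ⟨P, rfl, rfl⟩ := N.smooth.exists_point ((N.line_mem_tangents _ _).1 hm)
  refine ⟨_, _, N.isPonceletChain hφ P, ?_, ?_⟩ <;> simp [side]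

theorem addOrderOf_t {n : ℕ} (hn : 0 < n) (h : PonceletClosesAfter γ Γ n)
    (h' : ∀ m : ℕ, 0 < m → m < n → ¬ PonceletClosesAfter γ Γ m) : addOrderOf N.t = n := by
  rw [addOrderOf_eq_iff hn]
  exact ⟨N.nsmul_t_eq_zero_of_closes h, fun m hm hm0 hz =>
    h' m hm0 hm (N.closes_of_nsmul_t_eq_zero hz)⟩

/-- Two-torsion points are the branch points of the parameter: completing the square in `U` shows
that `(2U - dX + e²)²` is `e²` times the discriminant. -/
theorem add_self_eq_zero_iff (P : N.Pt) : P + P = 0 ↔ N.point (firstCoord P) ∈ γ.points := by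
  have he := N.smooth.e_ne_zero
  rw [N.point_mem_iff, add_eq_zero_iff_eq_neg]
  rcases P with _ | ⟨X, U, h⟩
  · simp only [firstCoord]
    constructor
    · rintro - z ⟨⟩
    · intro _; rfl
  · have hE := tateCurve_equation.1 h.1
    rw [WeierstrassCurve.Affine.Point.neg_some, WeierstrassCurve.Affine.Point.some.injEq]
    simp only [firstCoord, Option.some.injEq, forall_eq', true_and, WeierstrassCurve.Affine.negY]
    have key : N.e ^ 2 * ((N.d * (-X / N.e) + N.e) ^ 2 -
        4 * (-X / N.e) ^ 2 * (N.e * (-X / N.e) + N.f)) = (2 * U - N.d * X + N.e ^ 2) ^ 2 := by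
      field_simp
      linear_combination (-4) * hE
    constructor
    · intro hU
      rw [show 2 * U - N.d * X + N.e ^ 2 = 0 by linear_combination hU] at key
      simpa [he] using key
    · intro hz
      rw [hz, mul_zero] at key
      have := (pow_eq_zero_iff two_ne_zero).1 key.symm
      linear_combination this

theorem add_self_eq_neg_t_iff (P : N.Pt) : P + P = -N.t ↔ firstCoord (P + N.t) = firstCoord P := by
  rw [N.smooth.firstCoord_eq_iff, or_iff_right, eq_neg_iff_add_eq_zero, eq_neg_iff_add_eq_zero,
    add_right_comm]
  intro h
  have h0 : N.smooth.shift = 0 := add_eq_left.1 h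
  exact absurd N.smooth.shift_ne_neg_shift (by simp [h0])

/-- Both signs occur because the condition sees only the vertex, hence `P` up to negation. -/
theorem biquadratic_diag_iff (P : N.Pt) : Biquadratic N.d N.e N.f (firstCoord P) (firstCoord P) ↔
    P + P = -N.t ∨ P + P = N.t := by
  constructor
  · intro h
    obtain ⟨R, hR, hR'⟩ := N.smooth.exists_point h
    have h1 := (N.add_self_eq_neg_t_iff R).2 (hR'.trans hR.symm)
    rcases N.smooth.firstCoord_eq_iff.1 hR with rfl | rfl
    · exact Or.inl h1
    · right
      rw [← neg_add] at h1
      exact neg_injective h1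
  · rintro (h | h)
    · have := N.smooth.biquadratic_firstCoord P
      rwa [(N.add_self_eq_neg_t_iff P).1 h] at this
    · have h1 : -P + -P = -N.t := by rw [← neg_add, h]
      have := N.smooth.biquadratic_firstCoord (-P)
      rwa [(N.add_self_eq_neg_t_iff _).1 h1, firstCoord_neg] at this

/-- Passing to vertex `i` adds `2i • t` to `2P`. Even multiples can be moved to `0` (vertex on `γ`),
odd ones to `t` (common tangent). -/
theorem isDegeneratePolygon_iff {n : ℕ} {φ : ZMod n →+ N.Pt} (hφ : φ 1 = N.t) (P : N.Pt) :
    IsDegeneratePolygon γ Γ (fun i => N.point (firstCoord (P + φ i))) ↔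
      ∃ k : ℤ, P + P = k • N.t := by
  have hk : ∀ k : ℤ, φ k = k • N.t := fun k => by
    rw [← hφ, ← map_zsmul, zsmul_one]
  have hi : ∀ i : ZMod n, ∃ k : ℤ, φ i = k • N.t := fun i => by
    obtain ⟨k, rfl⟩ := ZMod.intCast_surjective i
    exact ⟨k, hk k⟩
  have crit : ∀ i, (N.point (firstCoord (P + φ i)) ∈ γ.points ∩ Γ.points ∨
      Γ.tangentLine (N.point (firstCoord (P + φ i))) ∈ γ.tangents) ↔
      (P + φ i + (P + φ i) = 0 ∨ P + φ i + (P + φ i) = -N.t ∨ P + φ i + (P + φ i) = N.t) := by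
    intro i
    rw [N.tangentLine_point, N.line_mem_tangents, N.biquadratic_diag_iff, N.add_self_eq_zero_iff,
      Set.mem_inter_iff, and_iff_left ((N.mem_points_iff _).2 ⟨_, rfl⟩)]
  have e : ∀ a b c c' : N.Pt, b = c → a - c' = b - c → a = c' := fun a b c c' h h' => by
    rw [h, sub_self] at h'
    exact sub_eq_zero.1 h'
  simp only [IsDegeneratePolygon, crit]
  constructor
  · rintro ⟨i, h⟩
    obtain ⟨k, hk⟩ := hi i
    rw [hk] at h
    rcases h with h | h | h
    · exact ⟨-2 * k, e _ _ _ _ h (by module)⟩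
    · exact ⟨-2 * k - 1, e _ _ _ _ h (by module)⟩
    · exact ⟨-2 * k + 1, e _ _ _ _ h (by module)⟩
  · rintro ⟨k, h⟩
    obtain ⟨j, rfl | rfl⟩ := Int.even_or_odd' k
    · refine ⟨((-j : ℤ) : ZMod n), Or.inl ?_⟩
      rw [hk]
      exact e _ _ _ _ h (by module)
    · refine ⟨((-j : ℤ) : ZMod n), Or.inr (Or.inr ?_)⟩
      rw [hk]
      exact e _ _ _ _ h (by module)

end NormalForm

/-! ### Root counts and the number of degenerate polygons. -/

theorem Polynomial.ncard_roots_of_no_double_root {p : Polynomial ℂ} (hp : p ≠ 0)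
    (h : ∀ x, p.eval x = 0 → p.derivative.eval x ≠ 0) :
    {x | p.eval x = 0}.ncard = p.natDegree := by
  have hs : p.Separable := by
    rw [Polynomial.separable_def, Polynomial.isCoprime_iff_aeval_ne_zero_of_isAlgClosed ℂ ℂ]
    intro a
    rw [Polynomial.coe_aeval_eq_eval]
    exact or_iff_not_imp_left.2 fun h' => h a (not_not.1 h')
  have key : {x | p.eval x = 0} = (p.roots.toFinset : Set ℂ) := by
    ext x
    simp [hp, Polynomial.IsRoot]
  rw [key, Set.ncard_coe_finset, Multiset.toFinset_card_of_nodup (Polynomial.nodup_roots hs)]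
  exact (IsAlgClosed.splits p).natDegree_eq_card_roots.symm

namespace BiquadraticSmooth

open Polynomial

variable {d e f : ℂ} (H : BiquadraticSmooth d e f)
include H

theorem ncard_discriminant_roots :
    {x : ℂ | (d * x + e) ^ 2 - 4 * x ^ 2 * (e * x + f) = 0}.ncard = 3 := by
  set p : ℂ[X] := C (-4 * e) * X ^ 3 + C (d ^ 2 - 4 * f) * X ^ 2 + C (2 * d * e) * X + C (e ^ 2)
    with hp
  have ha : -4 * e ≠ 0 := mul_ne_zero (by norm_num) H.e_ne_zero
  have hdeg : p.natDegree = 3 := natDegree_cubic ha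
  have hev : ∀ x, p.eval x = (d * x + e) ^ 2 - 4 * x ^ 2 * (e * x + f) := by
    intro x
    simp only [hp, eval_add, eval_mul, eval_C, eval_pow, eval_X]
    ring
  refine Eq.trans ?_ ((ncard_roots_of_no_double_root (p := p) ?_ ?_).trans hdeg)
  · simp only [hev]
  · rintro h
    rw [h] at hdeg
    simp at hdeg
  · intro x hx h'
    rw [hev] at hx
    refine H.no_double_root x hx ?_
    rw [← h', hp]
    simp only [derivative_add, derivative_mul, derivative_C, derivative_X_pow, derivative_X,
      eval_add, eval_mul, eval_C, eval_pow, eval_X, eval_zero, eval_one, Nat.cast_ofNat]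
    ring

theorem ncard_diagonal_roots :
    {x : ℂ | x ^ 4 + d * x ^ 2 + 2 * e * x + f = 0}.ncard = 4 := by
  set p : ℂ[X] := X ^ 4 + (C d * X ^ 2 + C (2 * e) * X + C f) with hp
  have hq : (C d * X ^ 2 + C (2 * e) * X + C f).degree < ((4 : ℕ) : WithBot ℕ) :=
    degree_quadratic_le.trans_lt (by norm_cast)
  have hdeg : p.natDegree = 4 :=
    natDegree_eq_of_degree_eq_some (degree_add_eq_left_of_degree_lt (by
      rwa [degree_X_pow]) |>.trans (degree_X_pow 4))
  have hev : ∀ x, p.eval x = x ^ 4 + d * x ^ 2 + 2 * e * x + f := by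
    intro x
    simp only [hp, eval_add, eval_mul, eval_C, eval_pow, eval_X]
    ring
  refine Eq.trans ?_ ((ncard_roots_of_no_double_root (p := p) ?_ ?_).trans hdeg)
  · simp only [hev]
  · rintro h
    rw [h] at hdeg
    simp at hdeg
  · intro x hx h'
    rw [hev] at hx
    refine H.diagonal_no_double_root hx ?_
    rw [← h', hp]
    simp only [derivative_add, derivative_mul, derivative_C, derivative_X_pow, derivative_X,
      eval_add, eval_mul, eval_C, eval_pow, eval_X, eval_zero, eval_one, Nat.cast_ofNat]
    ring

end BiquadraticSmooth

namespace NormalForm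

variable {γ Γ : Conic} (N : NormalForm γ Γ)

theorem ncard_add_self_eq_zero : {P : N.Pt | P + P = 0}.ncard = 4 := by
  have he := N.smooth.e_ne_zero
  set Z : Set ℂ := {x : ℂ | (N.d * x + N.e) ^ 2 - 4 * x ^ 2 * (N.e * x + N.f) = 0} with hZ
  have hZ3 : Z.ncard = 3 := N.smooth.ncard_discriminant_roots
  have hinj : Set.InjOn firstCoord {P : N.Pt | P + P = 0} := by
    intro P hP P' hP' h
    rcases N.smooth.firstCoord_eq_iff.1 h with h | h
    · exact h
    · exact h.trans (neg_eq_of_add_eq_zero_left hP')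
  have himg : firstCoord '' {P : N.Pt | P + P = 0} = insert none (some '' Z) := by
    ext x
    simp only [Set.mem_image, Set.mem_insert_iff, Set.mem_ofPred_eq, N.add_self_eq_zero_iff,
      N.point_mem_iff]
    constructor
    · rintro ⟨P, hP, rfl⟩
      rcases h : firstCoord P with _ | z
      · exact Or.inl rfl
      · exact Or.inr ⟨z, hP z h, rfl⟩
    · rintro (rfl | ⟨z, hz, rfl⟩)
      · exact ⟨0, by rintro z ⟨⟩, rfl⟩
      · have hz' : (N.d * z + N.e) ^ 2 - 4 * z ^ 2 * (N.e * z + N.f) = 0 := hz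
        have hz0 : z ≠ 0 := by
          rintro rfl
          simp [he] at hz'
        -- The second parameter is the double root of the form viewed as a quadratic in `y`.
        have hB : Biquadratic N.d N.e N.f (some z) (some (-(N.d * z + N.e) / (2 * z ^ 2))) := by
          change z ^ 2 * (-(N.d * z + N.e) / (2 * z ^ 2)) ^ 2
            + N.d * z * (-(N.d * z + N.e) / (2 * z ^ 2))
            + N.e * (z + (-(N.d * z + N.e) / (2 * z ^ 2))) + N.f = 0
          field_simp
          linear_combination -hz'
        obtain ⟨P, hP, -⟩ := N.smooth.exists_point hB
        refine ⟨P, fun w hw => ?_, hP⟩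
        obtain rfl : z = w := by rw [hP] at hw; exact Option.some.inj hw
        exact hz
  rw [← hinj.ncard_image, himg, Set.ncard_insert_of_notMem (by simp)
    ((Set.finite_of_ncard_ne_zero (by rw [hZ3]; norm_num)).image _),
    Set.ncard_image_of_injective _ (Option.some_injective _), hZ3]

/-- These are the four common tangents. The parameter is injective here, since `P` and `-P` both
doubling to `-t` would give `t = -t`. -/
theorem ncard_add_self_eq_neg_t : {P : N.Pt | P + P = -N.t}.ncard = 4 := by
  have hinj : Set.InjOn firstCoord {P : N.Pt | P + P = -N.t} := by
    intro P hP P' hP' h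
    rcases N.smooth.firstCoord_eq_iff.1 h with h | h
    · exact h
    · exfalso
      apply N.smooth.shift_ne_neg_shift
      rw [Set.mem_ofPred_eq] at hP hP'
      rw [h, ← neg_add, hP', neg_neg] at hP
      exact hP
  have himg : firstCoord '' {P : N.Pt | P + P = -N.t}
      = some '' {x : ℂ | x ^ 4 + N.d * x ^ 2 + 2 * N.e * x + N.f = 0} := by
    ext x
    simp only [Set.mem_image, Set.mem_ofPred_eq]
    constructor
    · rintro ⟨P, hP, rfl⟩
      have h : Biquadratic N.d N.e N.f _ _ := (N.biquadratic_diag_iff P).2 (Or.inl hP)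
      rcases hz : firstCoord P with _ | z
      · rw [hz] at h
        exact h.elim
      · rw [hz] at h
        refine ⟨z, ?_, rfl⟩
        have : z ^ 2 * z ^ 2 + N.d * z * z + N.e * (z + z) + N.f = 0 := h
        linear_combination this
    · rintro ⟨z, hz, rfl⟩
      have hB : Biquadratic N.d N.e N.f (some z) (some z) := by
        change z ^ 2 * z ^ 2 + N.d * z * z + N.e * (z + z) + N.f = 0
        linear_combination hz
      obtain ⟨P, hP, hP'⟩ := N.smooth.exists_point hB
      exact ⟨P, (N.add_self_eq_neg_t_iff P).2 (hP'.trans hP.symm), hP⟩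
  rw [← hinj.ncard_image, himg,
    Set.ncard_image_of_injective _ (Option.some_injective _), N.smooth.ncard_diagonal_roots]

theorem ncard_degenerate (N : NormalForm γ Γ) {n : ℕ} (hn : 0 < n) (h : PonceletClosesAfter γ Γ n)
    (h' : ∀ m : ℕ, 0 < m → m < n → ¬ PonceletClosesAfter γ Γ m) :
    {V : ZMod n → CP2 | IsPonceletPolygon γ Γ V ∧ IsDegeneratePolygon γ Γ V}.ncard = 4 * n := by
  obtain ⟨φ, hφ⟩ := N.exists_addMonoidHom (N.nsmul_t_eq_zero_of_closes h)
  set F : N.Pt → ZMod n → CP2 := fun P i => N.point (firstCoord (P + φ i)) with hF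
  -- Vertices `0` and `1` already determine the point, so forgetting the sides loses nothing.
  have hinj : Function.Injective F := by
    intro P P' hPP
    refine N.smooth.eq_of_firstCoord_eq ?_ ?_
    · simpa using N.point_injective (congrFun hPP 0)
    · have := N.point_injective (congrFun hPP 1)
      rwa [hφ] at this
  have himg : {V : ZMod n → CP2 | IsPonceletPolygon γ Γ V ∧ IsDegeneratePolygon γ Γ V}
      = F '' {P : N.Pt | ∃ k : ℤ, P + P = k • N.t} := by
    ext V
    simp only [Set.mem_ofPred_eq, Set.mem_image]
    constructor
    · rintro ⟨⟨l, hl⟩, hd⟩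
      obtain ⟨Q, hQ, hV⟩ := N.exists_of_isPonceletChain hl
      have hVF : F (Q 0) = V := by
        funext i
        rw [hV]
        change N.point (firstCoord (Q 0 + φ i)) = N.point (firstCoord (Q i))
        congr 2
        have : NeZero n := ⟨hn.ne'⟩
        rw [← ZMod.natCast_zmod_val i]
        induction i.val with
        | zero => simp
        | succ k ih => rw [Nat.cast_succ, hQ, ← ih, map_add, hφ, add_assoc]
      refine ⟨Q 0, ?_, hVF⟩
      rw [← N.isDegeneratePolygon_iff hφ]
      rwa [← hVF] at hd
    · rintro ⟨P, hP, rfl⟩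
      exact ⟨⟨_, N.isPonceletChain hφ P⟩, (N.isDegeneratePolygon_iff hφ P).2 hP⟩
  rw [himg, Set.ncard_image_of_injective _ hinj]
  exact ncard_add_self_mem_zmultiples hn (N.addOrderOf_t hn h h') N.ncard_add_self_eq_zero
    N.ncard_add_self_eq_neg_t

end NormalForm

/-! ### A common point of the conics and an adapted basis. -/

/-- A nondegenerate ternary quadric has a parametrization of degree two. -/
theorem Matrix.IsSymm.exists_parametrization {G : Matrix (Fin 3) (Fin 3) ℂ} (hG : G.IsSymm)
    (hdet : G.det ≠ 0) : ∃ u : Fin 3 → Fin 3 → ℂ, u 2 ≠ 0 ∧ ∀ s : ℂ,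
      u 0 + s • u 1 + s ^ 2 • u 2 ≠ 0 ∧ (u 2) ⬝ᵥ (G *ᵥ u 2) = 0 ∧
      (u 0 + s • u 1 + s ^ 2 • u 2) ⬝ᵥ (G *ᵥ (u 0 + s • u 1 + s ^ 2 • u 2)) = 0 := by
  -- Over `ℂ` the form becomes a sum of three squares, with isotropic curve `(1 - s², 2s, i(1 +
  -- s²))`; `u 2` is its point at `s = ∞`.
  obtain ⟨m, hm, ⟨φ⟩⟩ : ∃ m, m = 3 ∧ QuadraticMap.Equivalent
      (LinearMap.BilinMap.toQuadraticMap (Matrix.toLinearMap₂' ℂ G))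
      (QuadraticMap.weightedSumSquares ℂ (1 : Fin m → ℂ)) := by
    refine ⟨Module.finrank ℂ (Fin 3 → ℂ), by simp,
      QuadraticForm.equivalent_weightedSumSquares_of_isAlgClosed _ ?_⟩
    rw [QuadraticMap.associated_left_inverse]
    · exact LinearMap.separatingLeft_toLinearMap₂'_iff_det_ne_zero.2 hdet
    · intro x y
      rw [Matrix.toLinearMap₂'_apply', Matrix.toLinearMap₂'_apply', hG.dotProduct_mulVec_comm]
  subst hm
  have hQ : ∀ w : Fin 3 → ℂ, φ.symm w ⬝ᵥ (G *ᵥ φ.symm w) = w 0 * w 0 + w 1 * w 1 + w 2 * w 2 := by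
    intro w
    have h := φ.symm.map_app w
    rw [LinearMap.BilinMap.toQuadraticMap_apply, Matrix.toLinearMap₂'_apply'] at h
    rw [h, QuadraticMap.weightedSumSquares_apply, Fin.sum_univ_three]
    simp
  have hinj : ∀ w : Fin 3 → ℂ, w ≠ 0 → φ.symm w ≠ 0 := fun w hw h =>
    hw (φ.symm.toLinearEquiv.map_eq_zero_iff.1 h)
  have hI : Complex.I ^ 2 = -1 := Complex.I_sq
  have hlin : ∀ s : ℂ, φ.symm ![1, 0, Complex.I] + s • φ.symm ![0, 2, 0]
      + s ^ 2 • φ.symm ![-1, 0, Complex.I]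
      = φ.symm ![1 - s ^ 2, 2 * s, Complex.I * (1 + s ^ 2)] := by
    intro s
    change φ.symm.toLinearEquiv _ + s • φ.symm.toLinearEquiv _ + s ^ 2 • φ.symm.toLinearEquiv _
      = φ.symm.toLinearEquiv _
    rw [← map_smul, ← map_smul, ← map_add, ← map_add]
    congr 1
    ext i
    fin_cases i
    · simp; ring
    · simp; ring
    · simp; ring
  refine ⟨![φ.symm ![1, 0, Complex.I], φ.symm ![0, 2, 0], φ.symm ![-1, 0, Complex.I]], ?_,
    fun s => ⟨?_, ?_, ?_⟩⟩
  · exact hinj _ fun h => by simpa using congrFun h 0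
  · change φ.symm ![1, 0, Complex.I] + s • φ.symm ![0, 2, 0]
      + s ^ 2 • φ.symm ![-1, 0, Complex.I] ≠ 0
    rw [hlin]
    refine hinj _ fun h => ?_
    have h0 : 1 - s ^ 2 = 0 := congrFun h 0
    have h1 : 2 * s = 0 := congrFun h 1
    have h2 : s = 0 := by simpa using h1
    rw [h2] at h0
    norm_num at h0
  · change φ.symm ![-1, 0, Complex.I] ⬝ᵥ (G *ᵥ φ.symm ![-1, 0, Complex.I]) = 0
    rw [hQ]
    simp
  · change (φ.symm ![1, 0, Complex.I] + s • φ.symm ![0, 2, 0]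
      + s ^ 2 • φ.symm ![-1, 0, Complex.I]) ⬝ᵥ (G *ᵥ (φ.symm ![1, 0, Complex.I]
      + s • φ.symm ![0, 2, 0] + s ^ 2 • φ.symm ![-1, 0, Complex.I])) = 0
    rw [hlin, hQ]
    simp
    linear_combination (1 + s ^ 2) ^ 2 * hI

open Polynomial in
/-- Two conics have a common point. -/
theorem exists_common_zero {G : Matrix (Fin 3) (Fin 3) ℂ} (M : Matrix (Fin 3) (Fin 3) ℂ)
    (hG : G.IsSymm) (hdet : G.det ≠ 0) :
    ∃ v : Fin 3 → ℂ, v ≠ 0 ∧ v ⬝ᵥ (G *ᵥ v) = 0 ∧ v ⬝ᵥ (M *ᵥ v) = 0 := by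
  obtain ⟨u, hu2, hu⟩ := hG.exists_parametrization hdet
  -- This is the leading coefficient of the quartic in `s` obtained by restricting `M` to the curve.
  by_cases h2 : u 2 ⬝ᵥ (M *ᵥ u 2) = 0
  · exact ⟨u 2, hu2, (hu 0).2.1, h2⟩
  · set b : Fin 3 → Fin 3 → ℂ := fun i j => u i ⬝ᵥ (M *ᵥ u j) with hb
    set q : ℂ[X] := C (b 1 2 + b 2 1) * X ^ 3 + C (b 0 2 + b 1 1 + b 2 0) * X ^ 2
      + C (b 0 1 + b 1 0) * X + C (b 0 0) with hq
    have hdeg : (C (b 2 2) * X ^ 4 + q).degree = ((4 : ℕ) : WithBot ℕ) := by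
      rw [degree_add_eq_left_of_degree_lt, degree_C_mul_X_pow 4 h2]
      rw [degree_C_mul_X_pow 4 h2]
      exact degree_cubic_lt
    obtain ⟨s, hs⟩ := IsAlgClosed.exists_root _ (by rw [hdeg]; norm_num)
    refine ⟨_, (hu s).1, (hu s).2.2, ?_⟩
    rw [IsRoot, hq] at hs
    simp only [eval_add, eval_mul, eval_C, eval_pow, eval_X, hb] at hs
    simp only [Matrix.mulVec_add, Matrix.mulVec_smul, dotProduct_add, add_dotProduct,
      smul_dotProduct, dotProduct_smul, smul_eq_mul]
    linear_combination hs

theorem exists_orthogonal_not_smul (a v : Fin 3 → ℂ) :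
    ∃ z : Fin 3 → ℂ, z ⬝ᵥ a = 0 ∧ ∀ k : ℂ, z ≠ k • v := by
  by_contra! h
  set φ : (Fin 3 → ℂ) →ₗ[ℂ] ℂ :=
    { toFun := fun z => z ⬝ᵥ a
      map_add' := fun x y => add_dotProduct x y a
      map_smul' := fun c x => smul_dotProduct c x a } with hφ
  have hle : LinearMap.ker φ ≤ Submodule.span ℂ {v} := by
    intro z hz
    obtain ⟨k, hk⟩ := h z hz
    exact Submodule.mem_span_singleton.2 ⟨k, hk.symm⟩
  have h1 := (Submodule.finrank_mono hle).trans (finrank_span_le_card _)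
  have h2 := LinearMap.finrank_range_add_finrank_ker φ
  have h3 := Submodule.finrank_le (LinearMap.range φ)
  simp at h1 h2 h3
  omega

/-- An isotropic vector `v₀` and an anisotropic vector `v₂` orthogonal to it are completed to a
basis by an isotropic vector orthogonal to `v₂`. -/
theorem Matrix.IsSymm.exists_isotropic {G : Matrix (Fin 3) (Fin 3) ℂ} (hG : G.IsSymm)
    (hdet : G.det ≠ 0) {v₀ v₂ : Fin 3 → ℂ} (hv₀ : v₀ ≠ 0) (h00 : v₀ ⬝ᵥ (G *ᵥ v₀) = 0)
    (h20 : v₂ ⬝ᵥ (G *ᵥ v₀) = 0) (h22 : v₂ ⬝ᵥ (G *ᵥ v₂) ≠ 0) :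
    ∃ v₁, v₁ ⬝ᵥ (G *ᵥ v₁) = 0 ∧ v₁ ⬝ᵥ (G *ᵥ v₂) = 0 ∧
      v₁ ⬝ᵥ (G *ᵥ v₀) = -(v₂ ⬝ᵥ (G *ᵥ v₂)) / 2 := by
  have h02 : v₀ ⬝ᵥ (G *ᵥ v₂) = 0 := by rw [hG.dotProduct_mulVec_comm, h20]
  obtain ⟨z, hz⟩ : ∃ z, z ⬝ᵥ (G *ᵥ v₀) ≠ 0 := by
    by_contra! h
    have : G *ᵥ v₀ = 0 := dotProduct_eq_zero _ fun z => by rw [dotProduct_comm]; exact h z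
    exact hdet (Matrix.exists_mulVec_eq_zero_iff.1 ⟨v₀, hv₀, this⟩)
  set r := v₂ ⬝ᵥ (G *ᵥ v₂)
  obtain ⟨y, hy0, hy2⟩ : ∃ y, y ⬝ᵥ (G *ᵥ v₀) ≠ 0 ∧ y ⬝ᵥ (G *ᵥ v₂) = 0 := by
    refine ⟨z - ((z ⬝ᵥ (G *ᵥ v₂)) / r) • v₂, ?_, ?_⟩
    · rw [sub_dotProduct, smul_dotProduct, h20]
      simpa using hz
    · rw [sub_dotProduct, smul_dotProduct, smul_eq_mul, div_mul_cancel₀ _ h22, sub_self]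
  set m := y ⬝ᵥ (G *ᵥ v₀)
  have hm : v₀ ⬝ᵥ (G *ᵥ y) = m := hG.dotProduct_mulVec_comm _ _
  set q := y ⬝ᵥ (G *ᵥ y)
  -- Subtracting a multiple of `v₀` makes `y` isotropic; the factor normalizes its pairing with
  -- `v₀`.
  refine ⟨(-r / (2 * m)) • (y - (q / (2 * m)) • v₀), ?_, ?_, ?_⟩
  · simp only [Matrix.mulVec_sub, Matrix.mulVec_smul, dotProduct_sub, sub_dotProduct,
      smul_dotProduct, dotProduct_smul, smul_eq_mul, h00]
    rw [hm]
    change -r / (2 * m) * (-r / (2 * m) * (q - q / (2 * m) * m) - q / (2 * m) *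
      (-r / (2 * m) * (m - q / (2 * m) * 0))) = 0
    field_simp
    ring
  · simp only [sub_dotProduct, smul_dotProduct, smul_eq_mul, h02, hy2]
    ring
  · simp only [sub_dotProduct, smul_dotProduct, smul_eq_mul, h00]
    change -r / (2 * m) * (m - q / (2 * m) * 0) = -r / 2
    field_simp
    ring

/-- Conics in general position are simultaneously brought into the normal form which belongs to
a common point. -/
theorem InGeneralPosition.exists_basis {γ Γ : Conic} (h : InGeneralPosition γ Γ) :
    ∃ (R : Matrix (Fin 3) (Fin 3) ℂ) (a d e f : ℂ), R.det ≠ 0 ∧ a ≠ 0 ∧ e ≠ 0 ∧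
      R * Γ.mat * Rᵀ = a • !![0, 0, e; 0, -2 * e, 0; e, 0, 0] ∧
      R * γ.mat * Rᵀ = a • !![0, -2 * e, 0; -2 * e, d ^ 2 - 4 * f, d * e; 0, d * e, e ^ 2] := by
  obtain ⟨v₀, hv₀, hG00, hM00⟩ := exists_common_zero γ.mat Γ.symm Γ.det_ne_zero
  -- The pole, with respect to `Γ`, of the tangent of `γ` at `v₀`. If it were isotropic it would be
  -- a multiple of `v₀`, and the two tangents at `v₀` would coincide.
  set v₂ : Fin 3 → ℂ := Γ.mat⁻¹ *ᵥ (γ.mat *ᵥ v₀) with hv₂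
  have hGv₂ : Γ.mat *ᵥ v₂ = γ.mat *ᵥ v₀ := by
    rw [hv₂, Matrix.mulVec_mulVec, Matrix.mul_nonsing_inv _ Γ.smooth, Matrix.one_mulVec]
  have hG02 : v₀ ⬝ᵥ (Γ.mat *ᵥ v₂) = 0 := by rw [hGv₂, hM00]
  have hG20 : v₂ ⬝ᵥ (Γ.mat *ᵥ v₀) = 0 := by rw [Γ.symm.dotProduct_mulVec_comm, hG02]
  have hG22 : v₂ ⬝ᵥ (Γ.mat *ᵥ v₂) ≠ 0 := by
    intro hz
    obtain ⟨k, hk⟩ := Γ.symm.exists_smul_eq_of_isotropic Γ.det_ne_zero hv₀ hG00 hG02 hz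
    have hpar : γ.mat *ᵥ v₀ = k • (Γ.mat *ᵥ v₀) := by rw [← hGv₂, hk, Matrix.mulVec_smul]
    obtain ⟨z, hz0, hz⟩ := exists_orthogonal_not_smul (Γ.mat *ᵥ v₀) v₀
    have hzne : z ≠ 0 := by simpa using hz 0
    have hmem : Projectivization.mk ℂ z hzne ∈ {q | OnLine q (γ.tangentLine (.mk ℂ v₀ hv₀)) ∧
        OnLine q (Γ.tangentLine (.mk ℂ v₀ hv₀))} := by
      constructor
      · rw [Conic.tangentLine_mk, OnLine, Projectivization.orthogonal_mk, hpar, dotProduct_smul,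
          hz0, smul_zero]
      · rwa [Conic.tangentLine_mk, OnLine, Projectivization.orthogonal_mk]
    rw [h _ ⟨(γ.mk_mem_points hv₀).2 hM00, (Γ.mk_mem_points hv₀).2 hG00⟩] at hmem
    obtain ⟨k, hk⟩ := (Projectivization.mk_eq_mk_iff' ℂ _ _ _ _).1 hmem
    exact hz k hk.symm
  obtain ⟨v₁, hG11, hG12, hG10⟩ := Γ.symm.exists_isotropic Γ.det_ne_zero hv₀ hG00 hG20 hG22
  have hG21 : v₂ ⬝ᵥ (Γ.mat *ᵥ v₁) = 0 := by rw [Γ.symm.dotProduct_mulVec_comm, hG12]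
  obtain ⟨g, hg⟩ : ∃ g, v₂ ⬝ᵥ (Γ.mat *ᵥ v₂) = -2 * g := ⟨-(v₂ ⬝ᵥ (Γ.mat *ᵥ v₂)) / 2, by ring⟩
  have hg0 : g ≠ 0 := by rintro rfl; exact hG22 (by rw [hg]; ring)
  replace hG10 : v₁ ⬝ᵥ (Γ.mat *ᵥ v₀) = g := by rw [hG10, hg]; ring
  have hG01 : v₀ ⬝ᵥ (Γ.mat *ᵥ v₁) = g := by rw [Γ.symm.dotProduct_mulVec_comm, hG10]
  have hM20 : v₂ ⬝ᵥ (γ.mat *ᵥ v₀) = -2 * g := by rw [← hGv₂, hg]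
  have hM10 : v₁ ⬝ᵥ (γ.mat *ᵥ v₀) = 0 := by rw [← hGv₂, hG12]
  have hM02 : v₀ ⬝ᵥ (γ.mat *ᵥ v₂) = -2 * g := by rw [γ.symm.dotProduct_mulVec_comm, hM20]
  have hM01 : v₀ ⬝ᵥ (γ.mat *ᵥ v₁) = 0 := by rw [γ.symm.dotProduct_mulVec_comm, hM10]
  have hM21 := γ.symm.dotProduct_mulVec_comm v₂ v₁
  set μ := v₁ ⬝ᵥ (γ.mat *ᵥ v₁)
  set ν := v₁ ⬝ᵥ (γ.mat *ᵥ v₂)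
  set ρ := v₂ ⬝ᵥ (γ.mat *ᵥ v₂)
  set R : Matrix (Fin 3) (Fin 3) ℂ := Matrix.of ![v₀, v₂, v₁] with hR
  have entry : ∀ (A : Matrix (Fin 3) (Fin 3) ℂ) i j, (R * A * Rᵀ) i j = R i ⬝ᵥ (A *ᵥ R j) := by
    intro A i j
    rw [Matrix.dotProduct_mulVec]
    rfl
  have r0 : R 0 = v₀ := rfl
  have r1 : R 1 = v₂ := rfl
  have r2 : R 2 = v₁ := rfl
  have hΓ : R * Γ.mat * Rᵀ = !![0, 0, g; 0, -2 * g, 0; g, 0, 0] := by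
    ext i j
    rw [entry]
    fin_cases i <;> fin_cases j <;> simp [r0, r1, r2, hG00, hG01, hG02, hG10, hG11, hG12, hG20, hG21, hg]
  have hγ : R * γ.mat * Rᵀ = !![0, -2 * g, 0; -2 * g, ρ, ν; 0, ν, μ] := by
    ext i j
    rw [entry]
    fin_cases i <;> fin_cases j <;> simp [r0, r1, r2, hM00, hM01, hM02, hM10, hM20, hM21, μ, ν, ρ]
  have hRdet : R.det ≠ 0 := by
    intro hz
    have := congrArg Matrix.det hΓ
    rw [Matrix.det_mul, Matrix.det_mul, hz, zero_mul, zero_mul] at this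
    simp [Matrix.det_fin_three, hg0] at this
  have hμ : μ ≠ 0 := by
    intro hz
    have hne : (R * γ.mat * Rᵀ).det ≠ 0 := by
      rw [Matrix.det_mul, Matrix.det_mul, Matrix.det_transpose]
      exact mul_ne_zero (mul_ne_zero hRdet γ.det_ne_zero) hRdet
    rw [hγ] at hne
    simp [Matrix.det_fin_three, hz] at hne
  -- Matching Gram entries: `a e = g`, `a e² = μ`, `a d e = ν`, `a (d² - 4f) = ρ`.
  refine ⟨R, g ^ 2 / μ, ν / g, μ / g, ((ν / g) ^ 2 - ρ / (g ^ 2 / μ)) / 4, hRdet, ?_, ?_, ?_, ?_⟩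
  · exact div_ne_zero (pow_ne_zero _ hg0) hμ
  · exact div_ne_zero hμ hg0
  · rw [hΓ]
    ext i j
    fin_cases i <;> fin_cases j <;> simp <;> field_simp
  · rw [hγ]
    ext i j
    fin_cases i <;> fin_cases j <;> simp <;> field_simp
    ring

/-- A line is tangent exactly when its pole `u` lies on the conic. -/
theorem Conic.mk_mem_tangents (C : Conic) {L u : Fin 3 → ℂ} (hL : L ≠ 0) (hu : C.mat *ᵥ u = L) :
    Projectivization.mk ℂ L hL ∈ C.tangents ↔ u ⬝ᵥ (C.mat *ᵥ u) = 0 := by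
  have hu0 : u ≠ 0 := by
    rintro rfl
    exact hL (by rw [← hu, Matrix.mulVec_zero])
  subst hu
  rw [← C.mk_mem_points hu0]
  constructor
  · rintro ⟨p, hp, h⟩
    have : p = Projectivization.mk ℂ u hu0 :=
      Projectivization.map_injective _ C.toLin_injective (h.trans (C.tangentLine_mk hu0).symm)
    rwa [← this]
  · intro h
    exact ⟨_, h, C.tangentLine_mk hu0⟩

/-! ### Construction of the normal form. -/

namespace NormalForm

/-- The standard parametrization of the conic `x₁² = x₀ x₂`. -/
def pointVec : Option ℂ → Fin 3 → ℂ
  | none => ![1, 0, 0]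
  | some x => ![x ^ 2, x, 1]

/-- The line joining two points of the conic `x₁² = x₀ x₂`. -/
def lineVec : Option ℂ → Option ℂ → Fin 3 → ℂ
  | some x, some y => ![1, -(x + y), x * y]
  | none, some y => ![0, 1, -y]
  | some x, none => ![0, 1, -x]
  | none, none => ![0, 0, 1]

theorem pointVec_ne_zero (x : Option ℂ) : pointVec x ≠ 0 := by
  rcases x with _ | x
  · exact fun h => one_ne_zero (congrFun h 0)
  · exact fun h => one_ne_zero (congrFun h 2)

theorem lineVec_ne_zero (x y : Option ℂ) : lineVec x y ≠ 0 := by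
  rcases x with _ | x <;> rcases y with _ | y
  · exact fun h => one_ne_zero (congrFun h 2)
  · exact fun h => one_ne_zero (congrFun h 1)
  · exact fun h => one_ne_zero (congrFun h 1)
  · exact fun h => one_ne_zero (congrFun h 0)

theorem lineVec_comm (x y : Option ℂ) : lineVec x y = lineVec y x := by
  rcases x with _ | x <;> rcases y with _ | y
  · rfl
  · rfl
  · rfl
  · simp [lineVec, add_comm, mul_comm]

theorem pointVec_dotProduct_lineVec (t x y : Option ℂ) :
    pointVec t ⬝ᵥ lineVec x y = 0 ↔ t = x ∨ t = y := by
  rcases t with _ | t <;> rcases x with _ | x <;> rcases y with _ | y <;>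
    simp [pointVec, lineVec, dotProduct, Fin.sum_univ_three]
  · rw [← sub_eq_add_neg, sub_eq_zero]
  · rw [← sub_eq_add_neg, sub_eq_zero]
  · rw [← sub_eq_zero (a := t) (b := x), ← sub_eq_zero (a := t) (b := y), ← mul_eq_zero]
    ring_nf

theorem exists_pointVec {c : Fin 3 → ℂ} (hc : c ≠ 0) (h : c 1 ^ 2 = c 0 * c 2) :
    ∃ x, ∃ k : ℂ, k • c = pointVec x := by
  by_cases h2 : c 2 = 0
  · have h1 : c 1 = 0 := by simpa [h2] using h
    have h0 : c 0 ≠ 0 := fun h0 => hc (by ext i; fin_cases i <;> simp [*])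
    refine ⟨none, (c 0)⁻¹, ?_⟩
    ext i
    fin_cases i <;> simp [pointVec, *]
  · refine ⟨some (c 1 / c 2), (c 2)⁻¹, ?_⟩
    ext i
    fin_cases i
    · simp [pointVec]
      field_simp
      linear_combination -h
    · simp [pointVec]
      field_simp
    · simp [pointVec, h2]

open Polynomial in
theorem exists_lineVec {l : Fin 3 → ℂ} (hl : l ≠ 0) : ∃ x y, ∃ k : ℂ, k • l = lineVec x y := by
  by_cases h0 : l 0 = 0
  · by_cases h1 : l 1 = 0
    · have h2 : l 2 ≠ 0 := fun h2 => hl (by ext i; fin_cases i <;> simp [*])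
      refine ⟨none, none, (l 2)⁻¹, ?_⟩
      ext i
      fin_cases i <;> simp [lineVec, *]
    · refine ⟨none, some (-l 2 / l 1), (l 1)⁻¹, ?_⟩
      ext i
      fin_cases i
      · simp [lineVec, h0]
      · simp [lineVec, h1]
      · simp [lineVec]
        field_simp
  · obtain ⟨x, hx⟩ := IsAlgClosed.exists_root (C (l 0) * X ^ 2 + C (l 1) * X + C (l 2))
      (by rw [degree_quadratic h0]; norm_num)
    simp only [IsRoot, eval_add, eval_mul, eval_C, eval_pow, eval_X] at hx
    refine ⟨some x, some (-l 1 / l 0 - x), (l 0)⁻¹, ?_⟩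
    ext i
    fin_cases i
    · simp [lineVec, h0]
    · simp [lineVec]
      field_simp
    · simp [lineVec]
      field_simp
      linear_combination hx

end NormalForm

open NormalForm in
/-- Two conics in general position have a normal form. -/
theorem InGeneralPosition.nonempty_normalForm {γ Γ : Conic} (h : InGeneralPosition γ Γ) :
    Nonempty (NormalForm γ Γ) := by
  obtain ⟨R, a, d, e, f, hR, ha, he, hΓ, hγ⟩ := h.exists_basis
  have hRu : IsUnit R.det := isUnit_iff_ne_zero.2 hR
  have hRT : IsUnit Rᵀ.det := by rwa [Matrix.det_transpose]
  have inj1 : ∀ c : Fin 3 → ℂ, c ≠ 0 → Rᵀ *ᵥ c ≠ 0 := fun c hc h0 =>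
    hRT.ne_zero (Matrix.exists_mulVec_eq_zero_iff.1 ⟨c, hc, h0⟩)
  have inj2 : ∀ l : Fin 3 → ℂ, l ≠ 0 → R⁻¹ *ᵥ l ≠ 0 := fun l hl h0 => hl (by
    rw [← Matrix.one_mulVec l, ← Matrix.mul_nonsing_inv R hRu, ← Matrix.mulVec_mulVec, h0,
      Matrix.mulVec_zero])
  have dot : ∀ c L : Fin 3 → ℂ, (Rᵀ *ᵥ c) ⬝ᵥ L = c ⬝ᵥ (R *ᵥ L) := fun c L => by
    rw [Matrix.mulVec_transpose, Matrix.dotProduct_mulVec]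
  have RRinv : ∀ l : Fin 3 → ℂ, R *ᵥ (R⁻¹ *ᵥ l) = l := fun l => by
    rw [Matrix.mulVec_mulVec, Matrix.mul_nonsing_inv R hRu, Matrix.one_mulVec]
  have RinvR : ∀ l : Fin 3 → ℂ, R⁻¹ *ᵥ (R *ᵥ l) = l := fun l => by
    rw [Matrix.mulVec_mulVec, Matrix.nonsing_inv_mul R hRu, Matrix.one_mulVec]
  have RTsurj : ∀ v : Fin 3 → ℂ, ∃ c, Rᵀ *ᵥ c = v := fun v => ⟨Rᵀ⁻¹ *ᵥ v, by
    rw [Matrix.mulVec_mulVec, Matrix.mul_nonsing_inv _ hRT, Matrix.one_mulVec]⟩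
  have RΓ : ∀ c : Fin 3 → ℂ, R *ᵥ (Γ.mat *ᵥ (Rᵀ *ᵥ c))
      = ![a * (e * c 2), a * (-2 * e * c 1), a * (e * c 0)] := fun c => by
    rw [Matrix.mulVec_mulVec, Matrix.mulVec_mulVec, hΓ]
    ext i
    fin_cases i <;> simp [Matrix.mulVec, dotProduct, Fin.sum_univ_three] <;> ring
  have Rγ : ∀ c : Fin 3 → ℂ, R *ᵥ (γ.mat *ᵥ (Rᵀ *ᵥ c))
      = ![a * (-2 * e * c 1), a * (-2 * e * c 0 + (d ^ 2 - 4 * f) * c 1 + d * e * c 2),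
        a * (d * e * c 1 + e ^ 2 * c 2)] := fun c => by
    rw [Matrix.mulVec_mulVec, Matrix.mulVec_mulVec, hγ]
    ext i
    fin_cases i <;> simp [Matrix.mulVec, dotProduct, Fin.sum_univ_three] <;> ring
  have qΓ : ∀ c : Fin 3 → ℂ, (Rᵀ *ᵥ c) ⬝ᵥ (Γ.mat *ᵥ (Rᵀ *ᵥ c)) = 0 ↔ c 1 ^ 2 = c 0 * c 2 :=
    fun c => by
    rw [dot, RΓ, ← sub_eq_zero (a := c 1 ^ 2)]
    have : c ⬝ᵥ ![a * (e * c 2), a * (-2 * e * c 1), a * (e * c 0)]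
        = -2 * a * e * (c 1 ^ 2 - c 0 * c 2) := by
      simp [dotProduct, Fin.sum_univ_three]
      ring
    rw [this]
    simp [ha, he]
  have qγ : ∀ c : Fin 3 → ℂ, (Rᵀ *ᵥ c) ⬝ᵥ (γ.mat *ᵥ (Rᵀ *ᵥ c)) = a * (-4 * e * c 0 * c 1
      + (d ^ 2 - 4 * f) * c 1 ^ 2 + 2 * d * e * c 1 * c 2 + e ^ 2 * c 2 ^ 2) := fun c => by
    rw [dot, Rγ]
    simp [dotProduct, Fin.sum_univ_three]
    ring
  -- The rows of `R` are the basis, so points transform by `Rᵀ` and lines by `R⁻¹`; the parameter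
  -- `none` is a common point of the conics.
  set pt : Option ℂ → CP2 := fun x => .mk ℂ (Rᵀ *ᵥ pointVec x) (inj1 _ (pointVec_ne_zero x))
    with hpt
  set ln : Option ℂ → Option ℂ → LineCP2 := fun x y =>
    .mk ℂ (R⁻¹ *ᵥ lineVec x y) (inj2 _ (lineVec_ne_zero x y)) with hln
  have onLine : ∀ t x y, OnLine (pt t) (ln x y) ↔ t = x ∨ t = y := fun t x y => by
    rw [hpt, hln, OnLine, Projectivization.orthogonal_mk, dot, RRinv, pointVec_dotProduct_lineVec]
  have memΓ : ∀ x, pt x ∈ Γ.points := fun x => by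
    rw [hpt, Conic.mk_mem_points, qΓ]
    rcases x with _ | x <;> simp [pointVec]
  have memγ : ∀ x, pt (some x) ∈ γ.points ↔
      (d * x + e) ^ 2 - 4 * x ^ 2 * (e * x + f) = 0 := fun x => by
    rw [hpt, Conic.mk_mem_points, qγ, mul_eq_zero, or_iff_right ha]
    simp only [pointVec, Matrix.cons_val_zero, Matrix.cons_val_one, Matrix.cons_val]
    constructor <;> intro hx <;> linear_combination hx
  refine ⟨⟨d, e, f, ⟨he, ?_⟩, pt, ln, ?_, ?_, ?_, ?_, onLine, ?_, ?_, ?_⟩⟩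
  · intro x hx hx'
    have hp := (memγ x).2 hx
    -- The derivative of the parametrization. At a double root of the discriminant this second point
    -- lies on both tangents, against transversality.
    set c : Fin 3 → ℂ := ![2 * x, 1, 0] with hc
    have hc0 : c ≠ 0 := fun h0 => one_ne_zero (congrFun h0 1)
    have hmem : Projectivization.mk ℂ (Rᵀ *ᵥ c) (inj1 c hc0) ∈
        {q | OnLine q (γ.tangentLine (pt (some x))) ∧ OnLine q (Γ.tangentLine (pt (some x)))} := by
      constructor
      · rw [hpt, Conic.tangentLine_mk, OnLine, Projectivization.orthogonal_mk, dot, Rγ]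
        simp [dotProduct, Fin.sum_univ_three, pointVec, hc]
        linear_combination a / 2 * hx'
      · rw [hpt, Conic.tangentLine_mk, OnLine, Projectivization.orthogonal_mk, dot, RΓ]
        simp [dotProduct, Fin.sum_univ_three, pointVec, hc]
        ring
    rw [h _ ⟨hp, memΓ _⟩] at hmem
    have h1 : OnLine (Projectivization.mk ℂ (Rᵀ *ᵥ c) (inj1 c hc0)) (ln (some x) none) := by
      rw [show Projectivization.mk ℂ (Rᵀ *ᵥ c) (inj1 c hc0) = pt (some x) from hmem, onLine]
      exact Or.inl rfl
    rw [hln, OnLine, Projectivization.orthogonal_mk, dot, RRinv] at h1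
    simp [dotProduct, Fin.sum_univ_three, lineVec, hc] at h1
  · intro x y hxy
    have := (onLine y y y).2 (Or.inl rfl)
    rw [← hxy] at this
    simpa using (onLine x y y).1 this
  · intro p
    constructor
    · intro hp
      induction p using Projectivization.ind with | h v hv
      obtain ⟨c, rfl⟩ := RTsurj v
      have hc : c ≠ 0 := by rintro rfl; exact hv (Matrix.mulVec_zero _)
      rw [Conic.mk_mem_points, qΓ] at hp
      obtain ⟨x, k, hk⟩ := exists_pointVec hc hp
      exact ⟨x, (Projectivization.mk_eq_mk_iff' ℂ _ _ _ _).2 ⟨k, by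
        rw [← Matrix.mulVec_smul, hk]⟩⟩
    · rintro ⟨x, rfl⟩
      exact memΓ x
  · intro m
    induction m using Projectivization.ind with | h L hL
    have hl : R *ᵥ L ≠ 0 := by
      intro h0
      exact hL (by rw [← RinvR L, h0, Matrix.mulVec_zero])
    obtain ⟨x, y, k, hk⟩ := exists_lineVec hl
    exact ⟨x, y, (Projectivization.mk_eq_mk_iff' ℂ _ _ _ _).2 ⟨k, by
      rw [← hk, Matrix.mulVec_smul, RinvR]⟩⟩
  · intro x y
    simp only [hln, lineVec_comm x y]
  · intro x y
    obtain ⟨c, hc⟩ := RTsurj (γ.mat⁻¹ *ᵥ (R⁻¹ *ᵥ lineVec x y))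
    have hcL : γ.mat *ᵥ (Rᵀ *ᵥ c) = R⁻¹ *ᵥ lineVec x y := by
      rw [hc, Matrix.mulVec_mulVec, Matrix.mul_nonsing_inv _ γ.smooth, Matrix.one_mulVec]
    rw [hln, γ.mk_mem_tangents _ hcL, qγ]
    have hcl := Rγ c
    rw [hcL, RRinv] at hcl
    have l0 : lineVec x y 0 = a * (-2 * e * c 1) := congrFun hcl 0
    have l1 : lineVec x y 1 = a * (-2 * e * c 0 + (d ^ 2 - 4 * f) * c 1 + d * e * c 2) :=
      congrFun hcl 1
    have l2 : lineVec x y 2 = a * (d * e * c 1 + e ^ 2 * c 2) := congrFun hcl 2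
    -- The dual form of `γ` in line coordinates; at `(1, -(x + y), x y)` it is the biquadratic form.
    have key : a * e ^ 2 * (a * (-4 * e * c 0 * c 1 + (d ^ 2 - 4 * f) * c 1 ^ 2
        + 2 * d * e * c 1 * c 2 + e ^ 2 * c 2 ^ 2)) = lineVec x y 2 ^ 2
        + d * lineVec x y 2 * lineVec x y 0 - e * lineVec x y 1 * lineVec x y 0
        + f * lineVec x y 0 ^ 2 := by
      rw [l0, l1, l2]
      ring
    have hae : a * e ^ 2 ≠ 0 := mul_ne_zero ha (pow_ne_zero _ he)
    rw [← mul_eq_zero_iff_left hae, key]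
    rcases x with _ | x <;> rcases y with _ | y
    · simp [lineVec, Biquadratic]
    · simp [lineVec, Biquadratic]
    · simp [lineVec, Biquadratic]
    · simp only [lineVec, Biquadratic, Matrix.cons_val_zero, Matrix.cons_val_one, Matrix.cons_val]
      constructor <;> intro hx <;> linear_combination hx
  · intro x
    rw [hpt, hln, Conic.tangentLine_mk, Projectivization.mk_eq_mk_iff']
    refine ⟨a * e, ?_⟩
    rw [← RinvR (Γ.mat *ᵥ (Rᵀ *ᵥ pointVec x)), RΓ, ← Matrix.mulVec_smul]
    congr 1
    ext i
    rcases x with _ | x <;> fin_cases i <;> simp [lineVec, pointVec] <;> ring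
  · rintro (_ | x)
    · refine iff_of_true ?_ (by rintro z ⟨⟩)
      rw [hpt, Conic.mk_mem_points, qγ]
      simp [pointVec]
    · rw [memγ]
      simp

theorem mainTheorem4 (γ Γ : Conic) (n : ℕ) [NeZero n] (hn : 3 ≤ n)
    (hfam : PonceletClosesAfter γ Γ n) :
    (∀ W : ZMod n → ℂ × ℂ,
      IsPonceletPolygon γ Γ (fun i => finitePoint (W i)) →
      IsDegeneratePolygon γ Γ (fun i => finitePoint (W i)) →
      polygonArea W = 0) ∧
    ((∀ m : ℕ, 0 < m → m < n → ¬ PonceletClosesAfter γ Γ m) →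
      InGeneralPosition γ Γ →
      {V : ZMod n → CP2 | IsPonceletPolygon γ Γ V ∧ IsDegeneratePolygon γ Γ V}.ncard
        = 4 * n) := by
  refine ⟨fun W => polygonArea_eq_zero, fun hmin hgen => ?_⟩
  obtain ⟨N⟩ := hgen.nonempty_normalForm
  exact N.ncard_degenerate (by omega) hfam hmin
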